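/- Fix a dimension $d$. For $n,k\ge 1$, points $x_{i,j}\in\mathbb{Q}^d$ ($i\in[k]$, $j\in[n]$) and weights $\lambda_1,\dots,\lambda_k\in\mathbb{Q}_{>0}$, let $C\in(\mathbb{R}^n)^{\otimes k}$ be the barycenter cost tensor with entries $$C_{\vec\jmath}=\min_{y\in\mathbb{R}^d}\sum_{i=1}^k\lambda_i\|x_{i,j_i}-y\|^2,\qquad \vec\jmath=(j_1,\dots,j_k)\in[n]^k,$$ where $\|\cdot\|$ is the Euclidean norm. For potentials $p=(p_1,\dots,p_k)\in\mathbb{Q}^{n\times k}$, the oracle $\mathsf{SEP}(p)$ returns a tuple $$\mathsf{SEP}(p)\in\operatorname*{argmin}_{\vec\jmath\in[n]^k}\; C_{\vec\jmath}-\sum_{i=1}^k[p_i]_{j_i}.$$ Then $\mathsf{SEP}$ can be implemented in $\mathrm{poly}(n,k,\log U)$ time, where $\log U$ is the number of bits of precision of the input: there are a single deterministic algorithm and a polynomial $P$, both depending only on $d$, such that for all $n,k,L\ge 1$, given the points $x_{i,j}$, the weights $\lambda_i$ and the potentials $p$, where every number in the input is a rational whose numerator and denominator have at most $L$ bits each,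 the algorithm outputs such a tuple after at most $P(n,k,L)$ bit operations. (Time is counted on a random access machine over the integers with the logarithmic cost measure, i.e. each operation is charged according to the bit lengths of the numbers and addresses it handles.) -/

import Mathlib

namespace BarySep

/-! ### The cost tensor and the oracle problem -/

section Geometry

variable {d n k : ℕ}

/-- The barycenter cost tensor `C_j = min_y ∑ i, lam i * ‖x i (j i) - y‖²`, with `y` ranging over
Euclidean `d`-space. For positive weights the infimum is attained, see
`exists_eq_barycenterCost`. -/
noncomputable def barycenterCost (lam : Fin k → ℝ) (x : Fin k → Fin n → EuclideanSpace ℝ (Fin d))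
    (j : Fin k → Fin n) : ℝ :=
  ⨅ y : EuclideanSpace ℝ (Fin d), ∑ i, lam i * ‖x i (j i) - y‖ ^ 2

/-- `j` is a correct answer of the oracle on the query `p` for the cost tensor `C`: it belongs to
the argmin of `C j - ∑ i, p i (j i)` over all tuples `j`. -/
def IsSepAnswer (C : (Fin k → Fin n) → ℝ) (p : Fin k → Fin n → ℝ) (j : Fin k → Fin n) : Prop :=
  IsMinOn (fun l : Fin k → Fin n => C l - ∑ i, p i (l i)) Set.univ j

/-- For positive weights the infimum in `barycenterCost` is a minimum. -/
theorem exists_eq_barycenterCost (lam : Fin k → ℝ) (hlam : ∀ i, 0 < lam i)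
    (x : Fin k → Fin n → EuclideanSpace ℝ (Fin d)) (j : Fin k → Fin n) :
    ∃ y : EuclideanSpace ℝ (Fin d),
      barycenterCost lam x j = ∑ i, lam i * ‖x i (j i) - y‖ ^ 2 ∧
      ∀ z : EuclideanSpace ℝ (Fin d), barycenterCost lam x j ≤ ∑ i, lam i * ‖x i (j i) - z‖ ^ 2 := by
  have hb : BddBelow (Set.range fun y : EuclideanSpace ℝ (Fin d) =>
      ∑ i, lam i * ‖x i (j i) - y‖ ^ 2) :=
    ⟨0, by
      rintro _ ⟨y, rfl⟩
      exact Finset.sum_nonneg fun i _ => mul_nonneg (hlam i).le (sq_nonneg _)⟩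
  have hle := fun z => ciInf_le hb z
  suffices h : ∃ y : EuclideanSpace ℝ (Fin d), ∀ z : EuclideanSpace ℝ (Fin d),
      ∑ i, lam i * ‖x i (j i) - y‖ ^ 2 ≤ ∑ i, lam i * ‖x i (j i) - z‖ ^ 2 by
    obtain ⟨y, hy⟩ := h
    exact ⟨y, le_antisymm (hle y) (le_ciInf hy), hle⟩
  rcases isEmpty_or_nonempty (Fin k) with hk | hk
  · exact ⟨0, fun z => by simp⟩
  have hL : 0 < ∑ i, lam i := Finset.sum_pos (fun i _ => hlam i) Finset.univ_nonempty
  refine ⟨(∑ i, lam i)⁻¹ • ∑ i, lam i • x i (j i), fun z => ?_⟩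
  set y := (∑ i, lam i)⁻¹ • ∑ i, lam i • x i (j i) with hy
  have h0 : ∑ i, lam i • (x i (j i) - y) = 0 := by
    simp only [smul_sub, Finset.sum_sub_distrib, ← Finset.sum_smul]
    rw [hy, smul_smul, mul_inv_cancel₀ hL.ne', one_smul, sub_self]
  have h1 : ∀ i, lam i * ‖x i (j i) - z‖ ^ 2 = lam i * ‖x i (j i) - y‖ ^ 2
      + 2 * inner ℝ (lam i • (x i (j i) - y)) (y - z) + lam i * ‖y - z‖ ^ 2 := by
    intro i
    have h2 : x i (j i) - z = (x i (j i) - y) + (y - z) := by abel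
    rw [h2, norm_add_sq_real, real_inner_smul_left]
    ring
  simp only [h1, Finset.sum_add_distrib]
  rw [← Finset.mul_sum, ← sum_inner, h0, inner_zero_left, ← Finset.sum_mul]
  have := mul_nonneg hL.le (sq_nonneg ‖y - z‖)
  linarith

end Geometry

/-! ### The machine model

A random access machine over the integers with the logarithmic cost measure, programmed in a
structured language: integer variables, unbounded integer arrays with computed indices, integer
arithmetic, branching and loops. Every operation is charged according to the bit lengths of the
numbers and of the indices it handles. -/

/-- Memory: integer variables, and integer arrays. A program mentions only finitely many variables
and arrays, but may access array cells at computed indices. -/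
structure State where
  var : ℕ → ℤ
  arr : ℕ → ℕ → ℤ

/-- Number of bits of the absolute value of an integer. -/
def bits (z : ℤ) : ℕ := z.natAbs.size

/-- The arithmetic operations of the machine. -/
inductive Op
  | add
  | sub
  | mul
  | div

/-- Integer division rounds down for a positive divisor, and gives `0` for the divisor `0`. -/
def Op.eval : Op → ℤ → ℤ → ℤ
  | .add, a, b => a + b
  | .sub, a, b => a - b
  | .mul, a, b => a * b
  | .div, a, b => a / b

/-- Arithmetic expressions: constants, variables, array cells `a[e]`, and operations. -/
inductive Exp
  | const : ℤ → Exp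
  | var : ℕ → Exp
  | get : ℕ → Exp → Exp
  | op : Op → Exp → Exp → Exp

/-- Value of an expression. A negative index is read as index `0`. -/
def Exp.eval (s : State) : Exp → ℤ
  | .const c => c
  | .var v => s.var v
  | .get a e => s.arr a (e.eval s).toNat
  | .op o e f => o.eval (e.eval s) (f.eval s)

/-- Cost of evaluating an expression. Reading a number costs its bit length, an array access also
the bit length of the index, and an operation costs the product of the bit lengths of its operands
(the time of the schoolbook methods); every count is increased by one so that no step is free. -/
def Exp.cost (s : State) : Exp → ℕ
  | .const c => bits c + 1
  | .var v => bits (s.var v) + 1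
  | .get a e => e.cost s + bits (e.eval s) + bits (s.arr a (e.eval s).toNat) + 1
  | .op _ e f => e.cost s + f.cost s + (bits (e.eval s) + 1) * (bits (f.eval s) + 1)

/-- Programs. A test `e` succeeds if the value of `e` is positive. -/
inductive Prog
  | skip : Prog
  | assign : ℕ → Exp → Prog
  | store : ℕ → Exp → Exp → Prog
  | seq : Prog → Prog → Prog
  | ite : Exp → Prog → Prog → Prog
  | loop : Exp → Prog → Prog

/-- Assignment to a variable. -/
def State.setVar (s : State) (v : ℕ) (z : ℤ) : State :=
  { s with var := Function.update s.var v z }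

/-- Assignment to a cell of an array. -/
def State.setArr (s : State) (a i : ℕ) (z : ℤ) : State :=
  { s with arr := Function.update s.arr a (Function.update (s.arr a) i z) }

/-- `Runs c s t s'`: started in the state `s`, the program `c` halts in the state `s'` after time
exactly `t`. The program `loop e c` repeats `c` while the value of `e` is positive. -/
inductive Runs : Prog → State → ℕ → State → Prop
  | skip (s : State) : Runs .skip s 1 s
  | assign (s : State) (v : ℕ) (e : Exp) :
      Runs (.assign v e) s (e.cost s + bits (e.eval s) + 1) (s.setVar v (e.eval s))
  | store (s : State) (a : ℕ) (e f : Exp) :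
      Runs (.store a e f) s (e.cost s + f.cost s + bits (e.eval s) + bits (f.eval s) + 1)
        (s.setArr a (e.eval s).toNat (f.eval s))
  | seq (c₁ c₂ : Prog) (s s₁ s₂ : State) (t₁ t₂ : ℕ) :
      Runs c₁ s t₁ s₁ → Runs c₂ s₁ t₂ s₂ → Runs (.seq c₁ c₂) s (t₁ + t₂) s₂
  | ite_true (e : Exp) (c₁ c₂ : Prog) (s s' : State) (t : ℕ) :
      0 < e.eval s → Runs c₁ s t s' → Runs (.ite e c₁ c₂) s (e.cost s + 1 + t) s'
  | ite_false (e : Exp) (c₁ c₂ : Prog) (s s' : State) (t : ℕ) :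
      ¬ 0 < e.eval s → Runs c₂ s t s' → Runs (.ite e c₁ c₂) s (e.cost s + 1 + t) s'
  | loop_stop (e : Exp) (c : Prog) (s : State) :
      ¬ 0 < e.eval s → Runs (.loop e c) s (e.cost s + 1) s
  | loop_step (e : Exp) (c : Prog) (s s₁ s₂ : State) (t₁ t₂ : ℕ) :
      0 < e.eval s → Runs c s t₁ s₁ → Runs (.loop e c) s₁ t₂ s₂ →
      Runs (.loop e c) s (e.cost s + 1 + t₁ + t₂) s₂

/-- The machine is deterministic: final state and running time are determined by the program and
the initial state. -/
theorem Runs.det {c : Prog} {s s₁ s₂ : State} {t₁ t₂ : ℕ} (h₁ : Runs c s t₁ s₁)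
    (h₂ : Runs c s t₂ s₂) : t₁ = t₂ ∧ s₁ = s₂ := by
  induction h₁ generalizing t₂ s₂ with
  | skip s => cases h₂; exact ⟨rfl, rfl⟩
  | assign s v e => cases h₂; exact ⟨rfl, rfl⟩
  | store s a e f => cases h₂; exact ⟨rfl, rfl⟩
  | seq c₁ c₂ s u v t t' _ _ ih₁ ih₂ =>
    cases h₂ with
    | seq _ _ _ _ _ _ _ ha hb =>
      obtain ⟨rfl, rfl⟩ := ih₁ ha
      obtain ⟨rfl, rfl⟩ := ih₂ hb
      exact ⟨rfl, rfl⟩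
  | ite_true e c₁ c₂ s s' t he _ ih =>
    cases h₂ with
    | ite_true _ _ _ _ _ _ _ ha => obtain ⟨rfl, rfl⟩ := ih ha; exact ⟨rfl, rfl⟩
    | ite_false _ _ _ _ _ _ hn _ => exact absurd he hn
  | ite_false e c₁ c₂ s s' t he _ ih =>
    cases h₂ with
    | ite_true _ _ _ _ _ _ hn _ => exact absurd hn he
    | ite_false _ _ _ _ _ _ _ ha => obtain ⟨rfl, rfl⟩ := ih ha; exact ⟨rfl, rfl⟩
  | loop_stop e c s he =>
    cases h₂ with
    | loop_stop _ _ _ _ => exact ⟨rfl, rfl⟩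
    | loop_step _ _ _ _ _ _ _ hn _ _ => exact absurd hn he
  | loop_step e c s u v t t' he _ _ ih₁ ih₂ =>
    cases h₂ with
    | loop_stop _ _ _ hn => exact absurd he hn
    | loop_step _ _ _ _ _ _ _ _ ha hb =>
      obtain ⟨rfl, rfl⟩ := ih₁ ha
      obtain ⟨rfl, rfl⟩ := ih₂ hb
      exact ⟨rfl, rfl⟩

/-! ### Input and output -/

section Encoding

variable {d n k : ℕ}

/-- The array holding a finite list of integers, filled up with zeros. -/
def listArr {m : ℕ} (v : Fin m → ℤ) (a : ℕ) : ℤ :=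
  if h : a < m then v ⟨a, h⟩ else 0

/-- The `k × n` table of potentials, row by row: entry `(i, j)` at position `i * n + j`. -/
def flatPotentials (p : Fin k → Fin n → ℚ) (a : Fin (k * n)) : ℚ :=
  p a.divNat a.modNat

/-- The coordinates of the points: coordinate `t` of point `(i, j)` at position
`(i * n + j) * d + t`. -/
def flatPoints (x : Fin k → Fin n → Fin d → ℚ) (a : Fin (k * n * d)) : ℚ :=
  x a.divNat.divNat a.divNat.modNat a.modNat

/-- The initial memory: variables `0` and `1` hold `n` and `k`; arrays `0`, `1` hold the numerators
and denominators of the weights, arrays `2`, `3` those of the potentials, and arrays `4`, `5` those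
of the coordinates of the points. Everything else is zero. -/
def inputState (lam : Fin k → ℚ) (x : Fin k → Fin n → Fin d → ℚ) (p : Fin k → Fin n → ℚ) :
    State where
  var v := match v with
    | 0 => n
    | 1 => k
    | _ => 0
  arr a := match a with
    | 0 => listArr fun b => (lam b).num
    | 1 => listArr fun b => (lam b).den
    | 2 => listArr fun b => (flatPotentials p b).num
    | 3 => listArr fun b => (flatPotentials p b).den
    | 4 => listArr fun b => (flatPoints x b).num
    | 5 => listArr fun b => (flatPoints x b).den
    | _ => fun _ => 0

/-- The tuple `j` stands in the output array `6`, its indices being counted from `0`. -/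
def Outputs (s : State) (j : Fin k → Fin n) : Prop :=
  ∀ i : Fin k, s.arr 6 i = ((j i : ℕ) : ℤ)

/-- Numerator and denominator of the rational number `q` have at most `L` bits each. -/
def HasBits (q : ℚ) (L : ℕ) : Prop := bits q.num ≤ L ∧ bits q.den ≤ L

end Encoding

end BarySep

/-!
Multiplying weights, points and potentials by the product `D` of all denominators turns the problem
into one over the integers. Write `w i j = (v i j, c i j)` for the integer vectors with
`v i j = Λ i • X i j` and `c i j = Λ i * ‖X i j‖² - D² * P i j`, in terms of the scaled data, and `S`
for the sum of the `Λ i`. Inserting the barycenter shows that the quantity to be minimized is, up to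
a positive factor, `S * ∑ i, c i (j i) - ‖∑ i, v i (j i)‖²` (`objective`, `objective_eq`).

Let the tuple `j` be optimal, and put `u = (-2 ∑ i, v i (j i), S)`. Comparing `j` with the tuples
that differ from it in one place shows that `w i (j i)` is the only minimizer of the linear form `u`
among the vectors `w i 0, ..., w i (n - 1)` (`lin_dualPoint_lt`). Hence `j` is determined, up to
repetitions among the vectors, by the signs at `u` of the `k * n²` linear forms `w i b - w i a`.
So it suffices to test, for a set of points that meets every cell of this hyperplane arrangement,
the tuple minimizing the `w i ·` at each of the points (`objective_bestSample_le`).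

Such a set is found by recursion on the dimension in the manner of Fourier and Motzkin: eliminate
the last variable from all pairs of forms, and over each sample point of the resulting arrangement
take the means of any two zeros of the forms, shifted by `-1`, `0` or `1` (`exists_samplePoint`).
For fixed `d` the number of points is polynomial, although with an exponent exponential in `d`.

On the machine side, nothing is stored: the coordinates of all the forms and sample points are
functions of their numbers, recomputed whenever they are needed, with a recursion depth that
depends on `d` only. The class `PolyTime` of functions of the input and of some numbers is closed
under arithmetic, case distinction, substitution and polynomially bounded loops (in particular sums,
products and the search for a minimum). This yields the program without writing it down
(`PolyTime.answer`, `PolyTime.exists_prog`).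
-/

namespace BarySep

/-! ### Bit lengths -/

theorem bits_le_iff {z : ℤ} {m : ℕ} : bits z ≤ m ↔ z.natAbs < 2 ^ m := Nat.size_le

theorem natAbs_lt_two_pow_bits (z : ℤ) : z.natAbs < 2 ^ bits z := Nat.lt_size_self _

theorem bits_le_of_natAbs_le {y z : ℤ} (h : y.natAbs ≤ z.natAbs) : bits y ≤ bits z :=
  Nat.size_le_size h

theorem bits_le_natAbs (z : ℤ) : bits z ≤ z.natAbs :=
  bits_le_iff.2 Nat.lt_two_pow_self

theorem bits_natCast_le (m : ℕ) : bits (m : ℤ) ≤ m := by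
  simpa using bits_le_natAbs (m : ℤ)

theorem bits_zero : bits 0 = 0 := by simp [bits]

theorem bits_one : bits 1 = 1 := by simp [bits]

theorem bits_neg (z : ℤ) : bits (-z) = bits z := by simp [bits]

theorem bits_add_le (y z : ℤ) : bits (y + z) ≤ bits y + bits z + 1 := by
  rw [bits_le_iff]
  have hy := natAbs_lt_two_pow_bits y
  have hz := natAbs_lt_two_pow_bits z
  have h1 : 2 ^ bits y ≤ 2 ^ (bits y + bits z) := Nat.pow_le_pow_right two_pos (by omega)
  have h2 : 2 ^ bits z ≤ 2 ^ (bits y + bits z) := Nat.pow_le_pow_right two_pos (by omega)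
  have h3 := Int.natAbs_add_le y z
  rw [pow_succ]
  omega

theorem bits_sub_le (y z : ℤ) : bits (y - z) ≤ bits y + bits z + 1 := by
  simpa [sub_eq_add_neg, bits_neg] using bits_add_le y (-z)

theorem bits_mul_le (y z : ℤ) : bits (y * z) ≤ bits y + bits z := by
  rw [bits_le_iff, Int.natAbs_mul, pow_add]
  exact Nat.mul_lt_mul'' (natAbs_lt_two_pow_bits y) (natAbs_lt_two_pow_bits z)

theorem bits_div_le (y z : ℤ) : bits (y / z) ≤ bits y :=
  bits_le_of_natAbs_le (Int.natAbs_ediv_le_natAbs y z)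

theorem bits_eval_le (o : Op) (y z : ℤ) : bits (o.eval y z) ≤ bits y + bits z + 1 := by
  cases o
  · exact bits_add_le y z
  · exact bits_sub_le y z
  · exact (bits_mul_le y z).trans (Nat.le_succ _)
  · exact (bits_div_le y z).trans (by omega)

theorem bits_sum_le (f : ℕ → ℤ) (m B : ℕ) (h : ∀ i < m, bits (f i) ≤ B) :
    bits (∑ i ∈ Finset.range m, f i) ≤ m + B := by
  have key : (∑ i ∈ Finset.range m, f i).natAbs ≤ m * 2 ^ B := by
    refine (Int.natAbs_sum_le _ _).trans ?_
    refine (Finset.sum_le_card_nsmul _ _ (2 ^ B) fun i hi => ?_).trans (by simp)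
    exact (bits_le_iff.1 (h i (Finset.mem_range.1 hi))).le
  rw [bits_le_iff, pow_add]
  exact key.trans_lt (Nat.mul_lt_mul_of_pos_right Nat.lt_two_pow_self (by positivity))

theorem bits_prod_le (f : ℕ → ℤ) (m B : ℕ) (h : ∀ i < m, bits (f i) ≤ B) :
    bits (∏ i ∈ Finset.range m, f i) ≤ m * B + 1 := by
  induction m with
  | zero => simp [bits_one]
  | succ m ih =>
    rw [Finset.prod_range_succ]
    refine (bits_mul_le _ _).trans ?_
    have h1 := ih fun i hi => h i (by omega)
    have h2 := h m (by omega)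
    rw [Nat.succ_mul]
    omega

theorem State.setVar_var_of_ne {s : State} {v w : ℕ} (h : v ≠ w) (z : ℤ) :
    (s.setVar w z).var v = s.var v := Function.update_of_ne h _ _

/-! ### Inputs, contexts and polynomial bounds -/

/-- The part of an initial memory that algorithms read: two natural numbers `n`, `k` and a family
of integer arrays, together with a number `size` in which running times are measured. It bounds the
values of `n` and `k`, and the bit lengths of the array entries. -/
structure Input where
  n : ℕ
  k : ℕ
  arr : ℕ → ℕ → ℤ
  size : ℕ
  n_le : n ≤ size
  k_le : k ≤ size
  bits_arr_le : ∀ a i, bits (arr a i) ≤ size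

/-- Types whose elements are held in a machine variable as an integer. -/
class Coded (β : Type) where
  code : β → ℤ

instance : Coded ℤ := ⟨id⟩

instance : Coded ℕ := ⟨Nat.cast⟩

@[simp] theorem code_int (z : ℤ) : Coded.code z = z := rfl

@[simp] theorem code_nat (m : ℕ) : Coded.code m = (m : ℤ) := rfl

/-- The types `Input × β₁ × ⋯ × βᵣ` (associated to the left) of arguments of a computed function:
an element has an underlying input, and values of finitely many variables, of which the first two
are always `n` and `k`. -/
class Ctx (α : Type) where
  input : α → Input
  nvars : ℕ
  val : α → ℕ → ℤ
  two_le : 2 ≤ nvars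
  val_zero : ∀ a, val a 0 = (input a).n
  val_one : ∀ a, val a 1 = (input a).k

open Ctx Coded

instance : Ctx Input where
  input := id
  nvars := 2
  val I v := if v = 0 then I.n else I.k
  two_le := le_rfl
  val_zero _ := rfl
  val_one _ := rfl

instance {α β : Type} [Ctx α] [Coded β] : Ctx (α × β) where
  input a := input a.1
  nvars := nvars α + 1
  val a v := if v = nvars α then code a.2 else val a.1 v
  two_le := (two_le (α := α)).trans (Nat.le_succ _)
  val_zero a := by
    have := two_le (α := α)
    rw [if_neg (by omega), val_zero]
  val_one a := by
    have := two_le (α := α)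
    rw [if_neg (by omega), val_one]

variable {α α' β γ : Type} [Ctx α] [Ctx α'] [Coded β] [Coded γ]

theorem nvars_prod : nvars (α × β) = nvars α + 1 := rfl

theorem val_prod (a : α × β) (v : ℕ) :
    val a v = if v = nvars α then code a.2 else val a.1 v := rfl

/-- The size of an argument: that of the input, plus the bit lengths of all the variables. -/
def sz (a : α) : ℕ := (input a).size + ∑ v ∈ Finset.range (nvars α), bits (val a v)

theorem sz_prod (a : α × β) : sz a = sz a.1 + bits (code a.2) := by
  unfold sz
  rw [nvars_prod, Finset.sum_range_succ, val_prod, if_pos rfl, ← add_assoc]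
  congr 2
  refine Finset.sum_congr rfl fun v hv => ?_
  rw [val_prod, if_neg (Finset.mem_range.1 hv).ne]

theorem size_le_sz (a : α) : (input a).size ≤ sz a := Nat.le_add_right _ _

theorem bits_val_le_sz (a : α) {v : ℕ} (hv : v < nvars α) : bits (val a v) ≤ sz a :=
  (Finset.single_le_sum (f := fun v => bits (val a v)) (fun _ _ => Nat.zero_le _)
    (Finset.mem_range.2 hv)).trans (Nat.le_add_left _ _)

/-- `h a` is at most polynomial in the size of `a`. -/
def PolyBounded (h : α → ℕ) : Prop := ∃ e, ∀ a, h a ≤ (sz a + 2) ^ e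

namespace PolyBounded

variable {g h : α → ℕ}

theorem mono (hh : PolyBounded h) (hle : ∀ a, g a ≤ h a) : PolyBounded g :=
  let ⟨e, he⟩ := hh
  ⟨e, fun a => (hle a).trans (he a)⟩

theorem const (m : ℕ) : PolyBounded fun _ : α => m :=
  ⟨m, fun a => (Nat.lt_two_pow_self (n := m)).le.trans (Nat.pow_le_pow_left (by omega) m)⟩

theorem add (hg : PolyBounded g) (hh : PolyBounded h) : PolyBounded fun a => g a + h a := by
  obtain ⟨e, he⟩ := hg
  obtain ⟨f, hf⟩ := hh
  refine ⟨max e f + 1, fun a => ?_⟩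
  have h1 := (he a).trans (Nat.pow_le_pow_right (by omega : 0 < sz a + 2) (le_max_left e f))
  have h2 := (hf a).trans (Nat.pow_le_pow_right (by omega : 0 < sz a + 2) (le_max_right e f))
  rw [pow_succ]
  nlinarith [Nat.zero_le ((sz a + 2) ^ max e f * sz a)]

theorem mul (hg : PolyBounded g) (hh : PolyBounded h) : PolyBounded fun a => g a * h a := by
  obtain ⟨e, he⟩ := hg
  obtain ⟨f, hf⟩ := hh
  exact ⟨e + f, fun a => by rw [pow_add]; exact Nat.mul_le_mul (he a) (hf a)⟩

theorem pow (hg : PolyBounded g) (m : ℕ) : PolyBounded fun a => g a ^ m := by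
  obtain ⟨e, he⟩ := hg
  exact ⟨e * m, fun a => by rw [pow_mul]; exact Nat.pow_le_pow_left (he a) m⟩

theorem self : PolyBounded fun a : α => sz a := ⟨1, fun a => by simp⟩

end PolyBounded

/-- A bound on `h (a, b)` that is polynomial in the size of the pair, when the bit length of `b` is
polynomial in the size of `a`. -/
theorem PolyBounded.exists_bound {h : α × β → ℕ} (hh : PolyBounded h) {B : α → ℕ}
    (hB : PolyBounded B) :
    ∃ H : α → ℕ, PolyBounded H ∧ ∀ a b, bits (code b) ≤ B a → h (a, b) ≤ H a := by
  obtain ⟨e, he⟩ := hh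
  refine ⟨fun a => (sz a + B a + 2) ^ e, ((PolyBounded.self.add hB).add (.const 2)).pow e,
    fun a b hb => (he (a, b)).trans (Nat.pow_le_pow_left ?_ e)⟩
  rw [sz_prod]
  dsimp only
  omega

/-! ### Functions computed in polynomial time -/

/-- In the state `s` the input arrays are intact, and the variables of the context have the values
prescribed by `a`, variable `v` standing at the place `ρ v`. -/
def Holds (ρ : ℕ → ℕ) (a : α) (s : State) : Prop :=
  (∀ A < 6, s.arr A = (input a).arr A) ∧ ∀ v < nvars α, s.var (ρ v) = val a v

theorem Holds.of_agree {ρ : ℕ → ℕ} {b : ℕ} {a : α} {s s' : State} (h : Holds ρ a s)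
    (hρ : ∀ v < nvars α, ρ v < b) (harr : s'.arr = s.arr) (hvar : ∀ v < b, s'.var v = s.var v) :
    Holds ρ a s' :=
  ⟨fun A hA => by rw [harr, h.1 A hA], fun v hv => by rw [hvar _ (hρ v hv), h.2 v hv]⟩

/-- Extending a context by a variable standing at the place `b`. -/
theorem Holds.extend {ρ : ℕ → ℕ} {a : α} {s : State} (h : Holds ρ a s) {b : ℕ}
    {y : β} (hy : s.var b = code y) :
    Holds (fun v => if v = nvars α then b else ρ v) (a, y) s := by
  refine ⟨h.1, fun v hv => ?_⟩
  rw [val_prod]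
  by_cases e : v = nvars α
  · simp only [if_pos e, hy]
  · simp only [if_neg e]
    exact h.2 v (by rw [nvars_prod] at hv; omega)

theorem extend_lt {ρ : ℕ → ℕ} {b b' : ℕ} (hρ : ∀ v < nvars α, ρ v < b)
    (hb : b < b') : ∀ v < nvars (α × β), (if v = nvars α then b else ρ v) < b' := by
  intro v hv
  rw [nvars_prod] at hv
  split
  · exact hb
  · exact (hρ v (by omega)).trans hb

/-- Started in the state `s`, the program `c` halts within time `T`, with the result `z` in the
variable `b`; it leaves the arrays and the variables below `b` alone. -/
def Delivers (c : Prog) (s : State) (T b : ℕ) (z : ℤ) : Prop :=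
  ∃ t s', Runs c s t s' ∧ t ≤ T ∧ s'.arr = s.arr ∧ (∀ v < b, s'.var v = s.var v) ∧ s'.var b = z

/-- Functions whose values have polynomial bit length and are computed in polynomial time. The
places `ρ` of the arguments, and the number `b` from which on the variables of the machine serve as
working memory, are arbitrary, so that programs can be combined without being relocated. -/
def PolyTime (f : α → β) : Prop :=
  PolyBounded (fun a => bits (code (f a))) ∧
  ∀ (ρ : ℕ → ℕ) (b : ℕ), (∀ v < nvars α, ρ v < b) →
    ∃ (c : Prog) (T : α → ℕ), PolyBounded T ∧
      ∀ a s, Holds ρ a s → Delivers c s (T a) b (code (f a))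

/-- A loop whose test stays positive for exactly `m` rounds, with an invariant `Inv i` that holds
before round `i`. -/
theorem runs_loop {e : Exp} {c : Prog} {T m : ℕ} (Inv : ℕ → State → Prop)
    (hstep : ∀ i < m, ∀ s, Inv i s → 0 < e.eval s ∧ e.cost s ≤ T ∧
      ∃ t s', Runs c s t s' ∧ t ≤ T ∧ Inv (i + 1) s')
    (hend : ∀ s, Inv m s → ¬ 0 < e.eval s ∧ e.cost s ≤ T) {s : State} (hs : Inv 0 s) :
    ∃ t s', Runs (.loop e c) s t s' ∧ t ≤ (m + 1) * (2 * T + 1) ∧ Inv m s' := by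
  suffices H : ∀ i ≤ m, ∀ s, Inv (m - i) s →
      ∃ t s', Runs (.loop e c) s t s' ∧ t ≤ (i + 1) * (2 * T + 1) ∧ Inv m s' from
    H m le_rfl s (by simpa using hs)
  intro i
  induction i with
  | zero =>
    intro _ s hs
    obtain ⟨h1, h2⟩ := hend s hs
    exact ⟨_, s, by apply Runs.loop_stop; exact h1, by omega, hs⟩
  | succ i ih =>
    intro hi s hs
    obtain ⟨h1, h2, t, s', hr, ht, hinv⟩ := hstep _ (by omega) s hs
    obtain ⟨t', s'', hr', ht', hinv'⟩ := ih (by omega) s' (by convert hinv using 1; omega)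
    refine ⟨_, s'', .loop_step e c s s' s'' t t' h1 hr hr', ?_, hinv'⟩
    rw [Nat.succ_mul]
    omega

namespace PolyTime

theorem of_eq {f g : α → β} (hf : PolyTime f) (h : ∀ a, f a = g a) : PolyTime g :=
  (funext h : f = g) ▸ hf

theorem natCast {f : α → ℕ} (hf : PolyTime f) : PolyTime fun a => (f a : ℤ) := hf

theorem of_natCast {f : α → ℕ} (hf : PolyTime fun a => (f a : ℤ)) : PolyTime f := hf

theorem const (z : β) : PolyTime fun _ : α => z := by
  refine ⟨.const _, fun ρ b _ => ⟨.assign b (.const (code z)), _,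
    .const (bits (code z) + 1 + bits (code z) + 1), fun a s _ => ⟨_, _, .assign _ _ _, le_rfl, rfl,
      fun v hv => ?_, ?_⟩⟩⟩
  · simp [State.setVar, hv.ne]
  · simp [State.setVar, Exp.eval]

/-- Arguments may be permuted, duplicated and forgotten. -/
theorem reindex {f : α' → β} (hf : PolyTime f) (φ : α → α') (σ : ℕ → ℕ)
    (hin : ∀ a, Ctx.input (φ a) = Ctx.input a) (hσ : ∀ v < nvars α', σ v < nvars α)
    (hval : ∀ a, ∀ v < nvars α', val (φ a) v = val a (σ v)) : PolyTime fun a => f (φ a) := by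
  have hsz : ∀ a, sz (φ a) ≤ (nvars α' + 1) * sz a := by
    intro a
    unfold sz
    rw [hin, Nat.add_mul, one_mul, add_comm]
    refine Nat.add_le_add ?_ (size_le_sz a)
    refine (Finset.sum_le_card_nsmul _ _ (sz a) fun v hv => ?_).trans (by simp [sz])
    rw [hval a v (Finset.mem_range.1 hv)]
    exact bits_val_le_sz a (hσ v (Finset.mem_range.1 hv))
  have hb : ∀ h : α' → ℕ, PolyBounded h → PolyBounded fun a => h (φ a) := by
    rintro h ⟨e, he⟩
    refine (((((PolyBounded.const (nvars α' + 1)).mul .self).add (.const 2)).pow e)).mono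
      fun a => (he (φ a)).trans (Nat.pow_le_pow_left ?_ e)
    have := hsz a
    omega
  refine ⟨hb _ hf.1, fun ρ b hρ => ?_⟩
  obtain ⟨c, T, hT, hc⟩ := hf.2 (fun v => ρ (σ v)) b fun v hv => hρ _ (hσ v hv)
  refine ⟨c, _, hb T hT, fun a s hs => hc (φ a) s ⟨fun A hA => ?_, fun v hv => ?_⟩⟩
  · rw [hin, hs.1 A hA]
  · rw [hval a v hv, hs.2 _ (hσ v hv)]

theorem var {v : ℕ} (hv : v < nvars α) : PolyTime fun a : α => val a v := by
  refine ⟨PolyBounded.self.mono fun a => bits_val_le_sz a hv, fun ρ b hρ =>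
    ⟨.assign b (.var (ρ v)), _, ((PolyBounded.self.add (.const 1)).add .self).add (.const 1),
      fun a s hs => ⟨_, _, .assign _ _ _, ?_, rfl, fun w hw => ?_, ?_⟩⟩⟩
  · have := bits_val_le_sz a hv
    simp only [Exp.cost, Exp.eval, hs.2 v hv]
    omega
  · simp [State.setVar, hw.ne]
  · simp [State.setVar, Exp.eval, hs.2 v hv]

theorem snd : PolyTime fun a : α × β => a.2 := by
  have := var (α := α × β) (v := nvars α) (by rw [nvars_prod]; omega)
  simp only [val_prod, if_pos] at this
  exact this

theorem fst {f : α → γ} (hf : PolyTime f) : PolyTime fun a : α × β => f a.1 := by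
  refine hf.reindex (fun a : α × β => a.1) id (fun _ => rfl)
    (fun v hv => by rw [nvars_prod]; exact Nat.lt_succ_of_lt hv) fun a v hv => ?_
  rw [id, val_prod, if_neg hv.ne]

theorem input_n : PolyTime fun a : α => (Ctx.input a).n := by
  have h := two_le (α := α)
  have := var (α := α) (v := 0) (by omega)
  simp only [val_zero] at this
  exact this

theorem input_k : PolyTime fun a : α => (Ctx.input a).k := by
  have h := two_le (α := α)
  have := var (α := α) (v := 1) (by omega)
  simp only [val_one] at this
  exact this

theorem op (o : Op) {f g : α → ℤ} (hf : PolyTime f) (hg : PolyTime g) :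
    PolyTime fun a => o.eval (f a) (g a) := by
  have hb := (hf.1.add hg.1).add (.const 1)
  have hb' := hb.mono fun a => bits_eval_le o (f a) (g a)
  refine ⟨hb', fun ρ b hρ => ?_⟩
  obtain ⟨c₁, T₁, hT₁, h₁⟩ := hf.2 ρ b hρ
  obtain ⟨c₂, T₂, hT₂, h₂⟩ := hg.2 ρ (b + 1) fun v hv => (hρ v hv).trans (Nat.lt_succ_self b)
  refine ⟨.seq c₁ (.seq c₂ (.assign b (.op o (.var b) (.var (b + 1))))), _,
    hT₁.add (hT₂.add ((((hf.1.add (.const 1)).add (hg.1.add (.const 1))).add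
      ((hf.1.add (.const 1)).mul (hg.1.add (.const 1)))).add (hb'.add (.const 1)))),
    fun a s hs => ?_⟩
  obtain ⟨t₁, s₁, r₁, ht₁, ha₁, hv₁, hr₁⟩ := h₁ a s hs
  obtain ⟨t₂, s₂, r₂, ht₂, ha₂, hv₂, hr₂⟩ := h₂ a s₁ (hs.of_agree hρ ha₁ hv₁)
  have e1 : s₂.var b = f a := by rw [hv₂ b (Nat.lt_succ_self b), hr₁, code_int]
  have e2 : s₂.var (b + 1) = g a := by rw [hr₂, code_int]
  refine ⟨_, _, .seq _ _ _ _ _ _ _ r₁ (.seq _ _ _ _ _ _ _ r₂ (.assign _ _ _)), ?_, ?_,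
    fun v hv => ?_, ?_⟩
  · simp only [Exp.cost, Exp.eval, e1, e2, code_int]
    omega
  · rw [State.setVar, ha₂, ha₁]
  · rw [State.setVar_var_of_ne hv.ne, hv₂ v (by omega), hv₁ v hv]
  · simp [State.setVar, Exp.eval, e1, e2]

theorem add {f g : α → ℤ} (hf : PolyTime f) (hg : PolyTime g) : PolyTime fun a => f a + g a :=
  op .add hf hg

theorem sub {f g : α → ℤ} (hf : PolyTime f) (hg : PolyTime g) : PolyTime fun a => f a - g a :=
  op .sub hf hg

theorem mul {f g : α → ℤ} (hf : PolyTime f) (hg : PolyTime g) : PolyTime fun a => f a * g a :=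
  op .mul hf hg

theorem div {f g : α → ℤ} (hf : PolyTime f) (hg : PolyTime g) : PolyTime fun a => f a / g a :=
  op .div hf hg

theorem pow {f : α → ℤ} (hf : PolyTime f) (m : ℕ) : PolyTime fun a => f a ^ m := by
  induction m with
  | zero => exact (const 1).of_eq fun a => (pow_zero _).symm
  | succ m ih => exact (ih.mul hf).of_eq fun a => (pow_succ _ _).symm

theorem nat_add {f g : α → ℕ} (hf : PolyTime f) (hg : PolyTime g) : PolyTime fun a => f a + g a :=
  of_natCast ((hf.natCast.add hg.natCast).of_eq fun a => by push_cast; rfl)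

theorem nat_mul {f g : α → ℕ} (hf : PolyTime f) (hg : PolyTime g) : PolyTime fun a => f a * g a :=
  of_natCast ((hf.natCast.mul hg.natCast).of_eq fun a => by push_cast; rfl)

theorem nat_div {f g : α → ℕ} (hf : PolyTime f) (hg : PolyTime g) : PolyTime fun a => f a / g a :=
  of_natCast ((hf.natCast.div hg.natCast).of_eq fun a => by push_cast; rfl)

theorem nat_mod {f g : α → ℕ} (hf : PolyTime f) (hg : PolyTime g) : PolyTime fun a => f a % g a :=
  of_natCast ((hf.natCast.sub (hg.natCast.mul (hf.natCast.div hg.natCast))).of_eq fun a => by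
    push_cast
    rw [Int.emod_def])

theorem finset_sum {f : α → ℕ → ℤ} (m : ℕ) (hf : ∀ t, PolyTime fun a => f a t) :
    PolyTime fun a => ∑ t ∈ Finset.range m, f a t := by
  induction m with
  | zero => exact (const 0).of_eq fun a => Finset.sum_range_zero _ |>.symm
  | succ m ih => exact (ih.add (hf m)).of_eq fun a => (Finset.sum_range_succ _ _).symm

/-- Reading an input array. -/
theorem read {A : ℕ} (hA : A < 6) {g : α → ℕ} (hg : PolyTime g) :
    PolyTime fun a => (Ctx.input a).arr A (g a) := by
  have hb : PolyBounded fun a : α => bits ((Ctx.input a).arr A (g a)) :=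
    PolyBounded.self.mono fun a => ((Ctx.input a).bits_arr_le A (g a)).trans (size_le_sz a)
  refine ⟨hb, fun ρ b hρ => ?_⟩
  obtain ⟨c, T, hT, h⟩ := hg.2 ρ b hρ
  refine ⟨.seq c (.assign b (.get A (.var b))), _,
    hT.add ((((hg.1.add (.const 1)).add hg.1).add (hb.add (.const 1))).add (hb.add (.const 1))),
    fun a s hs => ?_⟩
  obtain ⟨t, s', r, ht, ha, hv, hr⟩ := h a s hs
  have e : s'.arr A (s'.var b).toNat = (Ctx.input a).arr A (g a) := by
    rw [hr, ha, hs.1 A hA, code_nat, Int.toNat_natCast]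
  refine ⟨_, _, .seq _ _ _ _ _ _ _ r (.assign _ _ _), ?_, ha, fun v hvb => ?_, ?_⟩
  · simp only [hr] at e
    simp only [Exp.cost, Exp.eval, e, hr]
    omega
  · rw [State.setVar_var_of_ne hvb.ne, hv v hvb]
  · simp [State.setVar, Exp.eval, e]

theorem ite_pos {f : α → ℤ} {g h : α → β} (hf : PolyTime f) (hg : PolyTime g) (hh : PolyTime h) :
    PolyTime fun a => if 0 < f a then g a else h a := by
  refine ⟨(hg.1.add hh.1).mono fun a => by
    beta_reduce
    split <;> omega, fun ρ b hρ => ?_⟩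
  obtain ⟨c₁, T₁, hT₁, h₁⟩ := hf.2 ρ b hρ
  obtain ⟨c₂, T₂, hT₂, h₂⟩ := hg.2 ρ b hρ
  obtain ⟨c₃, T₃, hT₃, h₃⟩ := hh.2 ρ b hρ
  refine ⟨.seq c₁ (.ite (.var b) c₂ c₃), _,
    hT₁.add (((hf.1.add (.const 2)).add hT₂).add hT₃), fun a s hs => ?_⟩
  obtain ⟨t₁, s₁, r₁, ht₁, ha₁, hv₁, hr₁⟩ := h₁ a s hs
  have hs₁ := hs.of_agree hρ ha₁ hv₁
  have e : (Exp.var b).eval s₁ = f a := hr₁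
  by_cases hpos : 0 < f a
  · obtain ⟨t₂, s₂, r₂, ht₂, ha₂, hv₂, hr₂⟩ := h₂ a s₁ hs₁
    refine ⟨_, _, .seq _ _ _ _ _ _ _ r₁ (.ite_true _ _ _ _ _ _ (by rwa [e]) r₂), ?_,
      ha₂.trans ha₁, fun v hv => (hv₂ v hv).trans (hv₁ v hv), by simp only [hr₂, if_pos hpos]⟩
    simp only [Exp.cost, hr₁]
    omega
  · obtain ⟨t₂, s₂, r₂, ht₂, ha₂, hv₂, hr₂⟩ := h₃ a s₁ hs₁
    refine ⟨_, _, .seq _ _ _ _ _ _ _ r₁ (.ite_false _ _ _ _ _ _ (by rwa [e]) r₂), ?_,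
      ha₂.trans ha₁, fun v hv => (hv₂ v hv).trans (hv₁ v hv), by simp only [hr₂, if_neg hpos]⟩
    simp only [Exp.cost, hr₁]
    omega

theorem ite_lt {f₁ f₂ : α → ℤ} {g h : α → β} (hf₁ : PolyTime f₁) (hf₂ : PolyTime f₂)
    (hg : PolyTime g) (hh : PolyTime h) : PolyTime fun a => if f₁ a < f₂ a then g a else h a :=
  (ite_pos (hf₂.sub hf₁) hg hh).of_eq fun a => by simp only [sub_pos]

/-- Substitution of a computed value for the last argument. -/
theorem subst {f : α × β → γ} {g : α → β} (hf : PolyTime f) (hg : PolyTime g) :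
    PolyTime fun a => f (a, g a) := by
  obtain ⟨H, hH, hfH⟩ := PolyBounded.exists_bound hf.1 hg.1
  have hb : PolyBounded fun a => bits (code (f (a, g a))) := hH.mono fun a => hfH a _ le_rfl
  refine ⟨hb, fun ρ b hρ => ?_⟩
  obtain ⟨c₁, T₁, hT₁, h₁⟩ := hg.2 ρ b hρ
  obtain ⟨c₂, T₂, hT₂, h₂⟩ := hf.2 (fun v => if v = nvars α then b else ρ v) (b + 1)
    (extend_lt hρ (Nat.lt_succ_self b))
  obtain ⟨T₂', hT₂', hle⟩ := hT₂.exists_bound hg.1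
  refine ⟨.seq c₁ (.seq c₂ (.assign b (.var (b + 1)))), _,
    hT₁.add (hT₂'.add ((hb.add (.const 1)).add (hb.add (.const 1)))), fun a s hs => ?_⟩
  obtain ⟨t₁, s₁, r₁, ht₁, ha₁, hv₁, hr₁⟩ := h₁ a s hs
  obtain ⟨t₂, s₂, r₂, ht₂, ha₂, hv₂, hr₂⟩ := h₂ (a, g a) s₁ ((hs.of_agree hρ ha₁ hv₁).extend hr₁)
  have := hle a (g a) le_rfl
  refine ⟨_, _, .seq _ _ _ _ _ _ _ r₁ (.seq _ _ _ _ _ _ _ r₂ (.assign _ _ _)), ?_,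
    ha₂.trans ha₁, fun v hv => ?_, ?_⟩
  · simp only [Exp.cost, Exp.eval, hr₂]
    omega
  · rw [State.setVar_var_of_ne hv.ne, hv₂ v (by omega), hv₁ v hv]
  · simp [State.setVar, Exp.eval, hr₂]

/-- Substitution into a function of the input and one number. -/
theorem comp {f : Input → ℕ → ℤ} (hf : PolyTime fun a : Input × ℕ => f a.1 a.2) {g : α → ℕ}
    (hg : PolyTime g) : PolyTime fun a => f (Ctx.input a) (g a) := by
  have h2 := two_le (α := α)
  refine subst (f := fun a : α × ℕ => f (Ctx.input a.1) a.2) ?_ hg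
  refine hf.reindex (fun a : α × ℕ => (Ctx.input a.1, a.2)) (fun v => if v = 2 then nvars α else v)
    (fun _ => rfl) (fun v hv => ?_) fun a v hv => ?_
  · change v < 3 at hv
    rw [nvars_prod]
    split <;> omega
  · change v < 3 at hv
    interval_cases v
    · rw [val_zero, if_neg (by omega), val_zero]
      rfl
    · rw [val_one, if_neg (by omega), val_one]
      rfl
    · rw [if_pos rfl, val_prod a, if_pos rfl]
      rfl

/-- Bounded recursion, as a loop: the number of rounds has to be polynomial, and so have the bit
lengths of all the intermediate results. -/
theorem recursion {R : α → ℕ → β} {g : (α × ℕ) × β → β} (hz : PolyTime fun a => R a 0)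
    (hg : PolyTime g) (hR : ∀ a i, R a (i + 1) = g ((a, i), R a i)) {m : α → ℕ} (hm : PolyTime m)
    (hmb : PolyBounded m) {B : α → ℕ} (hB : PolyBounded B)
    (hle : ∀ a, ∀ i ≤ m a, bits (code (R a i)) ≤ B a) : PolyTime fun a => R a (m a) := by
  refine ⟨hB.mono fun a => hle a _ le_rfl, fun ρ b hρ => ?_⟩
  obtain ⟨c₁, T₁, hT₁, h₁⟩ := hz.2 ρ b hρ
  obtain ⟨c₂, T₂, hT₂, h₂⟩ := hm.2 ρ (b + 1) fun v hv => (hρ v hv).trans (by omega)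
  obtain ⟨c₃, T₃, hT₃, h₃⟩ := hg.2
    (fun v => if v = nvars (α × ℕ) then b else if v = nvars α then b + 2 else ρ v) (b + 3)
    (fun v hv => by
      rw [nvars_prod, nvars_prod] at hv
      split
      · omega
      · split
        · omega
        · exact (hρ v (by rw [nvars_prod] at *; omega)).trans (by omega))
  -- the time of one round of the loop, in terms of the size of `a`
  obtain ⟨T', hT', hle'⟩ : ∃ T' : α → ℕ, PolyBounded T' ∧ ∀ a i y, i ≤ m a →
      bits (code y) ≤ B a → T₃ ((a, i), y) ≤ T' a := by
    obtain ⟨e, he⟩ := hT₃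
    refine ⟨fun a => (sz a + m a + B a + 2) ^ e,
      (((PolyBounded.self.add hmb).add hB).add (.const 2)).pow e, fun a i y hi hy =>
        (he ((a, i), y)).trans (Nat.pow_le_pow_left ?_ e)⟩
    have := bits_natCast_le i
    rw [sz_prod, sz_prod]
    dsimp only [code_nat]
    omega
  refine ⟨.seq c₁ (.seq c₂ (.seq (.assign (b + 2) (.const 0))
    (.loop (.op .sub (.var (b + 1)) (.var (b + 2))) (.seq c₃ (.seq (.assign b (.var (b + 3)))
      (.assign (b + 2) (.op .add (.var (b + 2)) (.const 1)))))))),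
    fun a => T₁ a + (T₂ a + (2 + (m a + 1) *
      (2 * (T' a + 2 * B a + (m a + m a + 20) * (m a + m a + 20)) + 1))), ?_, fun a s hs => ?_⟩
  · exact hT₁.add (hT₂.add ((PolyBounded.const 2).add ((hmb.add (.const 1)).mul
      (((PolyBounded.const 2).mul ((hT'.add ((PolyBounded.const 2).mul hB)).add
        (((hmb.add hmb).add (.const 20)).mul ((hmb.add hmb).add (.const 20))))).add (.const 1)))))
  obtain ⟨t₁, s₁, r₁, ht₁, ha₁, hv₁, hr₁⟩ := h₁ a s hs
  obtain ⟨t₂, s₂, r₂, ht₂, ha₂, hv₂, hr₂⟩ := h₂ a s₁ (hs.of_agree hρ ha₁ hv₁)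
  set s₃ := s₂.setVar (b + 2) 0 with hs₃
  let Inv : ℕ → State → Prop := fun i u => u.arr = s.arr ∧ (∀ v < b, u.var v = s.var v) ∧
    u.var b = code (R a i) ∧ u.var (b + 1) = m a ∧ u.var (b + 2) = i
  have hinv : Inv 0 s₃ := by
    refine ⟨ha₂.trans ha₁, fun v hv => ?_, ?_, ?_, ?_⟩
    · rw [hs₃, State.setVar_var_of_ne (by omega), hv₂ v (by omega), hv₁ v hv]
    · rw [hs₃, State.setVar_var_of_ne (by omega), hv₂ b (by omega), hr₁]
    · rw [hs₃, State.setVar_var_of_ne (by omega), hr₂, code_nat]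
    · simp [hs₃, State.setVar]
  have hcost : ∀ i ≤ m a, ∀ u, Inv i u →
      (Exp.op .sub (.var (b + 1)) (.var (b + 2))).cost u ≤
        (m a + m a + 20) * (m a + m a + 20) := by
    rintro i hi u ⟨-, -, -, hum, hui⟩
    have h1 := bits_natCast_le i
    have h2 := bits_natCast_le (m a)
    simp only [Exp.cost, Exp.eval, hum, hui]
    nlinarith [Nat.mul_le_mul h2 (h1.trans hi)]
  obtain ⟨t, s', r, ht, hs'⟩ := runs_loop
    (T := T' a + 2 * B a + (m a + m a + 20) * (m a + m a + 20)) (m := m a)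
    (e := .op .sub (.var (b + 1)) (.var (b + 2)))
    (c := .seq c₃ (.seq (.assign b (.var (b + 3)))
      (.assign (b + 2) (.op .add (.var (b + 2)) (.const 1))))) Inv (fun i hi u hu => by
      refine ⟨?_, (hcost i hi.le u hu).trans (Nat.le_add_left _ _), ?_⟩
      · simp only [Exp.eval, Op.eval, hu.2.2.2.1, hu.2.2.2.2]
        omega
      obtain ⟨hua, huv, hub, hum, hui⟩ := hu
      have hua' : Holds ρ a u := hs.of_agree hρ hua huv
      obtain ⟨t₃, s₄, r₃, ht₃, ha₃, hv₃, hr₃⟩ := h₃ ((a, i), R a i) u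
        ((hua'.extend (b := b + 2) (y := i) hui).extend hub)
      have hbi := hle a i hi.le
      have hbi' := hle a (i + 1) hi
      have hT := hle' a i (R a i) hi.le hbi
      rw [← hR] at hr₃
      refine ⟨_, _, .seq _ _ _ _ _ _ _ r₃ (.seq _ _ _ _ _ _ _ (.assign _ _ _) (.assign _ _ _)),
        ?_, ?_, ?_, ?_, ?_, ?_⟩
      · have h1 := bits_natCast_le i
        have h2 := bits_natCast_le (i + 1)
        have e : s₄.var (b + 2) = i := by rw [hv₃ _ (by omega), hui]
        push_cast at h2
        simp only [Exp.cost, Exp.eval, Op.eval, State.setVar, hr₃, bits_one,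
          Function.update_of_ne (show b + 2 ≠ b by omega), e]
        nlinarith
      · exact ha₃.trans hua
      · intro v hv
        simp only [State.setVar]
        rw [Function.update_of_ne (by omega), Function.update_of_ne hv.ne, hv₃ v (by omega),
          huv v hv]
      · simp [State.setVar, Exp.eval, hr₃]
      · simp only [State.setVar]
        rw [Function.update_of_ne (by omega), Function.update_of_ne (by omega),
          hv₃ _ (by omega), hum]
      · have e : s₄.var (b + 2) = i := by rw [hv₃ _ (by omega), hui]
        simp [State.setVar, Exp.eval, Op.eval, e])
    (fun u hu => by
      refine ⟨?_, (hcost _ le_rfl u hu).trans (Nat.le_add_left _ _)⟩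
      simp only [Exp.eval, Op.eval, hu.2.2.2.1, hu.2.2.2.2]
      omega) hinv
  refine ⟨_, s', .seq _ _ _ _ _ _ _ r₁ (.seq _ _ _ _ _ _ _ r₂
    (.seq _ _ _ _ _ _ _ (.assign _ _ _) r)), ?_, hs'.1, hs'.2.1, hs'.2.2.1⟩
  simp only [Exp.cost, Exp.eval, bits_zero]
  omega

end PolyTime

/-! ### Sample points of hyperplane arrangements by Fourier-Motzkin elimination -/

/-- The value at `u` of the linear form with coefficients `h`, in `D` variables. -/
def lin (D : ℕ) (h u : ℕ → ℤ) : ℤ := ∑ t ∈ Finset.range D, h t * u t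

theorem lin_succ (D : ℕ) (h u : ℕ → ℤ) : lin (D + 1) h u = lin D h u + h D * u D :=
  Finset.sum_range_succ _ _

/-- The family of `M` linear forms `F` in `D + 1` variables, extended by the last coordinate. -/
def withLast (D M : ℕ) (F : ℕ → ℕ → ℤ) (m t : ℕ) : ℤ :=
  if m < M then F m t else if t = D then 1 else 0

/-- The form number `q = m * (M + 1) + l` among those obtained from the extended family by
eliminating the last variable from the forms number `m` and `l`. -/
def eliminate (D M : ℕ) (F : ℕ → ℕ → ℤ) (q t : ℕ) : ℤ :=
  withLast D M F (q / (M + 1)) D * withLast D M F (q % (M + 1)) t -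
    withLast D M F (q % (M + 1)) D * withLast D M F (q / (M + 1)) t

/-- The number of sample points for `M` linear forms in `D` variables. -/
def sampleCount : ℕ → ℕ → ℕ
  | 0, _ => 1
  | D + 1, M => sampleCount D ((M + 1) * (M + 1)) * ((M + 1) * (M + 1) * 3)

/-- The sample point over a point `y` that belongs to the forms `g` and `h`, and to the shift `s`:
the last coordinate is the mean of the zeros of `g (y, ·)` and `h (y, ·)`, plus `s - 1`, all scaled
by a positive number so as to become integral. -/
def lift (D : ℕ) (g h y : ℕ → ℤ) (s : ℕ) (t : ℕ) : ℤ :=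
  if t < D then 2 * (g D * h D) ^ 2 * y t
  else 2 * (g D * h D) ^ 2 * (s - 1) - (lin D g y * h D + lin D h y * g D) * (g D * h D)

/-- Sample points for the first `M` of the linear forms `F` in `D` variables: point number `q` is a
lift of point number `q / ((M + 1)² * 3)` for the forms without the last variable. -/
def samplePoint : (D M : ℕ) → (ℕ → ℕ → ℤ) → ℕ → ℕ → ℤ
  | 0, _, _ => fun _ _ => 0
  | D + 1, M, F => fun q =>
    lift D (withLast D M F (q / 3 % ((M + 1) * (M + 1)) / (M + 1)))
      (withLast D M F (q / 3 % ((M + 1) * (M + 1)) % (M + 1)))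
      (samplePoint D ((M + 1) * (M + 1)) (eliminate D M F) (q / 3 / ((M + 1) * (M + 1)))) (q % 3)

theorem lin_lift (D : ℕ) (f g h y : ℕ → ℤ) (s : ℕ) :
    lin (D + 1) f (lift D g h y s) =
      2 * (g D * h D) ^ 2 * lin D f y + f D * (2 * (g D * h D) ^ 2 * (s - 1) -
        (lin D g y * h D + lin D h y * g D) * (g D * h D)) := by
  rw [lin_succ]
  congr 1
  · unfold lin
    rw [Finset.mul_sum]
    refine Finset.sum_congr rfl fun t ht => ?_
    rw [lift, if_pos (Finset.mem_range.1 ht)]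
    ring
  · rw [lift, if_neg (lt_irrefl D)]

/-- In rational terms, the value of a form at a lifted point is a positive multiple of
`β + c * z`, where `z` is the mean of the two zeros plus the shift. -/
theorem lin_lift_pos_iff {D : ℕ} {f g h y : ℕ → ℤ} {s : ℕ} (hg : g D ≠ 0) (hh : h D ≠ 0) :
    0 < lin (D + 1) f (lift D g h y s) ↔
      (0 : ℚ) < lin D f y + f D * ((-lin D g y / g D + -lin D h y / h D) / 2 + (s - 1)) := by
  have hg' : (g D : ℚ) ≠ 0 := by exact_mod_cast hg
  have hh' : (h D : ℚ) ≠ 0 := by exact_mod_cast hh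
  have hpos : (0 : ℚ) < 2 * (g D * h D) ^ 2 := by positivity
  rw [← mul_pos_iff_of_pos_left hpos, lin_lift, ← Int.cast_pos (R := ℚ)]
  push_cast
  refine iff_of_eq (congrArg _ ?_)
  field_simp
  ring

theorem lin_eliminate (D M : ℕ) (F : ℕ → ℕ → ℤ) {m l : ℕ} (hl : l < M + 1) (y : ℕ → ℤ) :
    lin D (eliminate D M F (m * (M + 1) + l)) y =
      withLast D M F m D * lin D (withLast D M F l) y -
        withLast D M F l D * lin D (withLast D M F m) y := by
  have h1 : (m * (M + 1) + l) / (M + 1) = m := by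
    rw [mul_comm, Nat.mul_add_div (by omega), Nat.div_eq_of_lt hl, add_zero]
  have h2 : (m * (M + 1) + l) % (M + 1) = l := by
    rw [mul_comm, Nat.mul_add_mod, Nat.mod_eq_of_lt hl]
  unfold lin
  rw [Finset.mul_sum, Finset.mul_sum, ← Finset.sum_sub_distrib]
  refine Finset.sum_congr rfl fun t _ => ?_
  rw [eliminate, h1, h2]
  ring

/-- Every lift of a sample point for the eliminated forms is a sample point. -/
theorem exists_samplePoint_eq_lift (D M : ℕ) (F : ℕ → ℕ → ℤ) {q m l s : ℕ}
    (hq : q < sampleCount D ((M + 1) * (M + 1))) (hm : m < M + 1) (hl : l < M + 1) (hs : s < 3) :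
    ∃ r < sampleCount (D + 1) M, samplePoint (D + 1) M F r =
      lift D (withLast D M F m) (withLast D M F l)
        (samplePoint D ((M + 1) * (M + 1)) (eliminate D M F) q) s := by
  have hml : m * (M + 1) + l < (M + 1) * (M + 1) := by nlinarith
  set K := (M + 1) * (M + 1) with hK
  set e := m * (M + 1) + l with he
  have h1 : ((q * K + e) * 3 + s) / 3 = q * K + e := by omega
  have h2 : ((q * K + e) * 3 + s) % 3 = s := by omega
  have h3 : (q * K + e) / K = q := by
    rw [mul_comm, Nat.mul_add_div (by omega), Nat.div_eq_of_lt hml, add_zero]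
  have h4 : (q * K + e) % K = e := by rw [mul_comm, Nat.mul_add_mod, Nat.mod_eq_of_lt hml]
  have h5 : e / (M + 1) = m := by
    rw [he, mul_comm, Nat.mul_add_div (by omega), Nat.div_eq_of_lt hl, add_zero]
  have h6 : e % (M + 1) = l := by rw [he, mul_comm, Nat.mul_add_mod, Nat.mod_eq_of_lt hl]
  refine ⟨(q * K + e) * 3 + s, ?_, ?_⟩
  · have : sampleCount (D + 1) M = sampleCount D K * (K * 3) := rfl
    rw [this]
    have : (q + 1) * K ≤ sampleCount D K * K := Nat.mul_le_mul_right _ hq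
    nlinarith
  · rw [samplePoint]
    simp only [← hK, h1, h2, h3, h4, h5, h6]

/-- The sample points reach all cells: whatever strict inequalities `0 < F m` hold at a point `u`
hold together at one of the sample points. -/
theorem exists_samplePoint (D M : ℕ) (F : ℕ → ℕ → ℤ) (u : ℕ → ℤ) :
    ∃ q < sampleCount D M, ∀ m < M, 0 < lin D (F m) u → 0 < lin D (F m) (samplePoint D M F q) := by
  induction D generalizing M F with
  | zero => exact ⟨0, Nat.one_pos, fun m _ h => absurd h (by simp [lin])⟩
  | succ D ih =>
    obtain ⟨q, hq, hy⟩ := ih ((M + 1) * (M + 1)) (eliminate D M F)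
    set y := samplePoint D ((M + 1) * (M + 1)) (eliminate D M F) q with hydef
    set E := withLast D M F with hE
    have hEF : ∀ m < M, E m = F m := fun m hm => by
      funext t
      rw [hE, withLast, if_pos hm]
    have hlast : E M D = 1 := by simp [hE, withLast]
    have hlast0 : ∀ v, lin D (E M) v = 0 := fun v => Finset.sum_eq_zero fun t ht => by
      have := Finset.mem_range.1 ht
      simp [hE, withLast, this.ne]
    have hpair : ∀ m < M + 1, ∀ l < M + 1, 0 < E m D * lin D (E l) u - E l D * lin D (E m) u →
        0 < E m D * lin D (E l) y - E l D * lin D (E m) y := by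
      intro m hm l hl h
      have := hy (m * (M + 1) + l) (by nlinarith)
      rw [lin_eliminate D M F hl, lin_eliminate D M F hl] at this
      exact this h
    -- it suffices to find a suitable mean of zeros, as a value of the last coordinate over `y`
    suffices H : ∃ m < M + 1, ∃ l < M + 1, ∃ s < 3, E m D ≠ 0 ∧ E l D ≠ 0 ∧
        ∀ i < M, 0 < lin (D + 1) (E i) u → (0 : ℚ) < lin D (E i) y + E i D *
          ((-lin D (E m) y / E m D + -lin D (E l) y / E l D) / 2 + ((s : ℕ) - 1)) by
      obtain ⟨m, hm, l, hl, s, hs, hm0, hl0, H⟩ := H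
      obtain ⟨r, hr, hrl⟩ := exists_samplePoint_eq_lift D M F hq hm hl hs
      refine ⟨r, hr, fun i hi h => ?_⟩
      rw [← hEF i hi] at h ⊢
      rw [hrl]
      exact (lin_lift_pos_iff hm0 hl0).2 (H i hi h)
    -- forms without the last variable
    have hflat : ∀ i < M, 0 < lin (D + 1) (E i) u → E i D = 0 → (0 : ℚ) < lin D (E i) y := by
      intro i hi h h0
      rw [lin_succ, h0, zero_mul, add_zero] at h
      have := hpair M (by omega) i (by omega)
      rw [hlast, hlast0, hlast0] at this
      simp only [one_mul, mul_zero, sub_zero] at this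
      exact_mod_cast this h
    set z : ℕ → ℚ := fun i => -lin D (E i) y / E i D with hz
    -- the forms bounding the last coordinate from below, and those bounding it from above
    set A := (Finset.range M).filter fun i => 0 < lin (D + 1) (E i) u ∧ 0 < E i D with hA
    set B := (Finset.range M).filter fun i => 0 < lin (D + 1) (E i) u ∧ E i D < 0 with hB
    have memA : ∀ i, i ∈ A ↔ i < M ∧ 0 < lin (D + 1) (E i) u ∧ 0 < E i D := by simp [hA]
    have memB : ∀ i, i ∈ B ↔ i < M ∧ 0 < lin (D + 1) (E i) u ∧ E i D < 0 := by simp [hB]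
    have hAB : ∀ i ∈ A, ∀ j ∈ B, z i < z j := by
      intro i hi j hj
      rw [memA] at hi
      rw [memB] at hj
      obtain ⟨hi, hiu, hic⟩ := hi
      obtain ⟨hj, hju, hjc⟩ := hj
      have h := hpair i (by omega) j (by omega) (by
        rw [lin_succ] at hiu hju
        nlinarith [mul_pos hic hju, mul_pos (neg_pos.2 hjc) hiu])
      have hic' : (0 : ℚ) < E i D := by exact_mod_cast hic
      have hjc' : (0 : ℚ) < -E j D := by exact_mod_cast neg_pos.2 hjc
      have h' : (0 : ℚ) < E i D * lin D (E j) y - E j D * lin D (E i) y := by exact_mod_cast h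
      have e : z j = lin D (E j) y / (-E j D : ℚ) := by
        rw [hz]
        simp only
        rw [div_neg, neg_div]
      rw [e, hz]
      simp only
      rw [div_lt_div_iff₀ hic' hjc']
      linarith
    -- a last coordinate strictly between the bounds satisfies all the inequalities
    have hfin : ∀ w : ℚ, (∀ i ∈ A, z i < w) → (∀ j ∈ B, w < z j) →
        ∀ i < M, 0 < lin (D + 1) (E i) u → (0 : ℚ) < lin D (E i) y + E i D * w := by
      intro w hw1 hw2 i hi h
      rcases lt_trichotomy (E i D) 0 with hc | hc | hc
      · have h1 := hw2 i ((memB i).2 ⟨hi, h, hc⟩)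
        have hc' : (E i D : ℚ) < 0 := by exact_mod_cast hc
        rw [hz] at h1
        simp only at h1
        rw [lt_div_iff_of_neg hc'] at h1
        linarith
      · rw [hc]
        simpa using hflat i hi h hc
      · have h1 := hw1 i ((memA i).2 ⟨hi, h, hc⟩)
        have hc' : (0 : ℚ) < E i D := by exact_mod_cast hc
        rw [hz] at h1
        simp only at h1
        rw [div_lt_iff₀ hc'] at h1
        linarith
    rcases A.eq_empty_or_nonempty with hA0 | hA0
    · rcases B.eq_empty_or_nonempty with hB0 | hB0
      · refine ⟨M, by omega, M, by omega, 0, by omega, by omega, by omega, hfin _ ?_ ?_⟩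
        · simp [hA0]
        · simp [hB0]
      · obtain ⟨l, hl, hmin⟩ := B.exists_min_image z hB0
        have hl' := (memB l).1 hl
        refine ⟨l, by omega, l, by omega, 0, by omega, by omega, by omega, hfin _ ?_ ?_⟩
        · simp [hA0]
        · intro j hj
          have := hmin j hj
          change (z l + z l) / 2 + _ < _
          push_cast
          linarith
    · obtain ⟨m, hm, hmax⟩ := A.exists_max_image z hA0
      have hm' := (memA m).1 hm
      rcases B.eq_empty_or_nonempty with hB0 | hB0
      · refine ⟨m, by omega, m, by omega, 2, by omega, by omega, by omega, hfin _ ?_ ?_⟩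
        · intro i hi
          have := hmax i hi
          change _ < (z m + z m) / 2 + _
          push_cast
          linarith
        · simp [hB0]
      · obtain ⟨l, hl, hmin⟩ := B.exists_min_image z hB0
        have hl' := (memB l).1 hl
        have hml := hAB m hm l hl
        refine ⟨m, by omega, l, by omega, 1, by omega, by omega, by omega, hfin _ ?_ ?_⟩
        · intro i hi
          have := hmax i hi
          change _ < (z m + z l) / 2 + _
          push_cast
          linarith
        · intro j hj
          have := hmin j hj
          change (z m + z l) / 2 + _ < _
          push_cast
          linarith

/-! ### Bounded loops, and the sample points in polynomial time -/

theorem sz_input (I : Input) : sz I = I.size + (bits I.n + bits I.k) := by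
  simp [sz, Ctx.input, nvars, val, Finset.sum_range_succ]

theorem PolyBounded.input_n : PolyBounded fun a : α => (Ctx.input a).n :=
  self.mono fun a => (Ctx.input a).n_le.trans (size_le_sz a)

theorem PolyBounded.input_k : PolyBounded fun a : α => (Ctx.input a).k :=
  self.mono fun a => (Ctx.input a).k_le.trans (size_le_sz a)

/-- The smallest position below `m` at which `f` attains its minimum over the numbers below `m`. -/
def argminBelow (f : ℕ → ℤ) : ℕ → ℕ
  | 0 => 0
  | m + 1 => if f m < f (argminBelow f m) then m else argminBelow f m

theorem argminBelow_le (f : ℕ → ℤ) (m : ℕ) : argminBelow f m ≤ m := by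
  induction m with
  | zero => exact le_rfl
  | succ m ih =>
    rw [argminBelow]
    split <;> omega

theorem argminBelow_lt (f : ℕ → ℤ) {m : ℕ} (hm : 0 < m) : argminBelow f m < m := by
  obtain ⟨m, rfl⟩ : ∃ l, m = l + 1 := ⟨m - 1, by omega⟩
  have := argminBelow_le f m
  rw [argminBelow]
  split <;> omega

theorem argminBelow_min (f : ℕ → ℤ) {m i : ℕ} (hi : i < m) : f (argminBelow f m) ≤ f i := by
  induction m with
  | zero => omega
  | succ m ih =>
    rw [argminBelow]
    rcases Nat.lt_succ_iff_lt_or_eq.1 hi with h | rfl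
    · have := ih h
      split <;> omega
    · split <;> omega

namespace PolyTime

theorem ite_nat_lt {f₁ f₂ : α → ℕ} {g h : α → β} (hf₁ : PolyTime f₁) (hf₂ : PolyTime f₂)
    (hg : PolyTime g) (hh : PolyTime h) : PolyTime fun a => if f₁ a < f₂ a then g a else h a :=
  (ite_lt hf₁.natCast hf₂.natCast hg hh).of_eq fun a => by simp only [Nat.cast_lt]

section Fold

variable {f : α → ℕ → ℤ} {m : α → ℕ}

theorem exists_bits_bound (hf : PolyTime fun a : α × ℕ => f a.1 a.2) (hmb : PolyBounded m) :
    ∃ H : α → ℕ, PolyBounded H ∧ ∀ a, ∀ i ≤ m a, bits (f a i) ≤ H a := by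
  obtain ⟨H, hH, h⟩ := hf.1.exists_bound hmb
  exact ⟨H, hH, fun a i hi => h a i ((bits_natCast_le i).trans hi)⟩

theorem sum (hm : PolyTime m) (hmb : PolyBounded m) (hf : PolyTime fun a : α × ℕ => f a.1 a.2) :
    PolyTime fun a => ∑ i ∈ Finset.range (m a), f a i := by
  obtain ⟨H, hH, h⟩ := hf.exists_bits_bound hmb
  refine recursion (R := fun a i => ∑ i ∈ Finset.range i, f a i)
    (g := fun a => a.2 + f a.1.1 a.1.2) ((const 0).of_eq fun _ => Finset.sum_range_zero _ |>.symm)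
    (snd.add hf.fst) (fun a i => ?_) hm hmb (hmb.add hH) fun a i hi => ?_
  · exact Finset.sum_range_succ _ _
  · exact (bits_sum_le _ i (H a) fun j hj => h a j (by omega)).trans (by omega)

theorem prod (hm : PolyTime m) (hmb : PolyBounded m) (hf : PolyTime fun a : α × ℕ => f a.1 a.2) :
    PolyTime fun a => ∏ i ∈ Finset.range (m a), f a i := by
  obtain ⟨H, hH, h⟩ := hf.exists_bits_bound hmb
  refine recursion (R := fun a i => ∏ i ∈ Finset.range i, f a i)
    (g := fun a => a.2 * f a.1.1 a.1.2) ((const 1).of_eq fun _ => Finset.prod_range_zero _ |>.symm)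
    (snd.mul hf.fst) (fun a i => Finset.prod_range_succ _ _) hm hmb
    ((hmb.mul hH).add (.const 1)) fun a i hi => ?_
  exact (bits_prod_le _ i (H a) fun j hj => h a j (by omega)).trans
    (Nat.succ_le_succ (Nat.mul_le_mul_right _ hi))

theorem argmin (hm : PolyTime m) (hmb : PolyBounded m)
    (hf : PolyTime fun a : α × ℕ => f a.1 a.2) : PolyTime fun a => argminBelow (f a) (m a) := by
  have h1 : PolyTime fun a : (α × ℕ) × ℕ => f a.1.1 a.2 := by
    refine hf.reindex (fun a : (α × ℕ) × ℕ => (a.1.1, a.2))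
      (fun v => if v = nvars α then nvars α + 1 else v) (fun _ => rfl) (fun v hv => ?_)
      fun a v hv => ?_
    · rw [nvars_prod] at hv
      rw [nvars_prod, nvars_prod]
      split <;> omega
    · rw [nvars_prod] at hv
      simp only [val_prod, nvars_prod]
      by_cases e : v = nvars α
      · simp [e]
      · have : v ≠ nvars α + 1 := by omega
        simp [e, this]
  refine recursion (R := fun a i => argminBelow (f a) i)
    (g := fun a => if f a.1.1 a.1.2 < f a.1.1 a.2 then a.1.2 else a.2) (const 0)
    (ite_lt hf.fst h1 snd.fst snd) (fun a i => rfl) hm hmb hmb fun a i hi => ?_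
  exact (bits_natCast_le _).trans ((argminBelow_le _ _).trans hi)

end Fold

/-- Substitution into a function of the input and two numbers. -/
theorem comp₂ {f : Input → ℕ → ℕ → β} (hf : PolyTime fun a : (Input × ℕ) × ℕ => f a.1.1 a.1.2 a.2)
    {g h : α → ℕ} (hg : PolyTime g) (hh : PolyTime h) :
    PolyTime fun a => f (Ctx.input a) (g a) (h a) := by
  have h2 := two_le (α := α)
  refine subst (f := fun a : α × ℕ => f (Ctx.input a.1) a.2 (h a.1)) ?_ hg
  refine subst (f := fun a : (α × ℕ) × ℕ => f (Ctx.input a.1.1) a.1.2 a.2)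
    (g := fun a : α × ℕ => h a.1) ?_ hh.fst
  refine hf.reindex (fun a : (α × ℕ) × ℕ => ((Ctx.input a.1.1, a.1.2), a.2))
    (fun v => if v = 2 then nvars α else if v = 3 then nvars α + 1 else v)
    (fun _ => rfl) (fun v hv => ?_) fun a v hv => ?_
  · change v < 4 at hv
    rw [nvars_prod, nvars_prod]
    split
    · omega
    · split <;> omega
  · change v < 4 at hv
    interval_cases v
    · rw [val_zero, if_neg (by omega), if_neg (by omega), val_zero]
      rfl
    · rw [val_one, if_neg (by omega), if_neg (by omega), val_one]
      rfl
    · rw [if_pos rfl, val_prod a, nvars_prod, if_neg (by omega), val_prod a.1, if_pos rfl]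
      rfl
    · rw [if_neg (by omega), if_pos rfl, val_prod a, nvars_prod, if_pos rfl]
      rfl

theorem lin {D : ℕ} {f g : α → ℕ → ℤ} (hf : ∀ t, PolyTime fun a => f a t)
    (hg : ∀ t, PolyTime fun a => g a t) : PolyTime fun a => lin D (f a) (g a) :=
  finset_sum D fun t => (hf t).mul (hg t)

section SamplePoint

variable {M : Input → ℕ} {F : Input → ℕ → ℕ → ℤ}

theorem withLast {D : ℕ} (hM : PolyTime M) (hF : ∀ t, PolyTime fun a : Input × ℕ => F a.1 a.2 t)
    (t : ℕ) : PolyTime fun a : Input × ℕ => withLast D (M a.1) (F a.1) a.2 t :=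
  ite_nat_lt snd hM.fst (hF t) (const _)

theorem eliminate {D : ℕ} (hM : PolyTime M) (hF : ∀ t, PolyTime fun a : Input × ℕ => F a.1 a.2 t)
    (t : ℕ) : PolyTime fun a : Input × ℕ => eliminate D (M a.1) (F a.1) a.2 t := by
  have hM1 : PolyTime fun a : Input × ℕ => M a.1 + 1 := hM.fst.nat_add (const 1)
  have h1 : ∀ t, PolyTime _ := fun t =>
    comp (f := fun I m => BarySep.withLast D (M I) (F I) m t) (withLast hM hF t) (snd.nat_div hM1)
  have h2 : ∀ t, PolyTime _ := fun t =>
    comp (f := fun I m => BarySep.withLast D (M I) (F I) m t) (withLast hM hF t) (snd.nat_mod hM1)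
  exact ((h1 D).mul (h2 t)).sub ((h2 D).mul (h1 t))

theorem lift {D : ℕ} {g h y : α → ℕ → ℤ} {s : α → ℕ} (hg : ∀ t, PolyTime fun a => g a t)
    (hh : ∀ t, PolyTime fun a => h a t) (hy : ∀ t, PolyTime fun a => y a t) (hs : PolyTime s)
    (t : ℕ) : PolyTime fun a => lift D (g a) (h a) (y a) (s a) t := by
  unfold BarySep.lift
  have hgh := (hg D).mul (hh D)
  have h2 := (const 2).mul (hgh.pow 2)
  split
  · exact h2.mul (hy t)
  · exact (h2.mul (hs.natCast.sub (const 1))).sub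
      ((((lin hg hy).mul (hh D)).add ((lin hh hy).mul (hg D))).mul hgh)

theorem sampleCount (D : ℕ) (hM : PolyTime M) (hMb : PolyBounded M) :
    PolyTime (fun I => sampleCount D (M I)) ∧ PolyBounded fun I => sampleCount D (M I) := by
  induction D generalizing M with
  | zero => exact ⟨const 1, .const 1⟩
  | succ D ih =>
    have h1 := hM.nat_add (const 1)
    have h2 := hMb.add (.const 1)
    obtain ⟨h3, h4⟩ := ih (h1.nat_mul h1) (h2.mul h2)
    exact ⟨h3.nat_mul ((h1.nat_mul h1).nat_mul (const 3)), h4.mul ((h2.mul h2).mul (.const 3))⟩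

theorem samplePoint (D : ℕ) (hM : PolyTime M) (hF : ∀ t, PolyTime fun a : Input × ℕ => F a.1 a.2 t)
    (t : ℕ) : PolyTime fun a : Input × ℕ => samplePoint D (M a.1) (F a.1) a.2 t := by
  induction D generalizing M F t with
  | zero => exact const 0
  | succ D ih =>
    have h1 := hM.nat_add (const 1)
    have h2 := h1.nat_mul h1
    have hq : PolyTime fun a : Input × ℕ => a.2 / 3 := snd.nat_div (const 3)
    have hy := fun t => comp
      (f := fun I q => BarySep.samplePoint D ((M I + 1) * (M I + 1))
        (BarySep.eliminate D (M I) (F I)) q t)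
      (ih (F := fun I => BarySep.eliminate D (M I) (F I)) h2 (eliminate hM hF) t) (hq.nat_div h2.fst)
    have hE := fun t (g : Input × ℕ → ℕ) (hg : PolyTime g) =>
      comp (f := fun I m => BarySep.withLast D (M I) (F I) m t) (withLast hM hF t) hg
    exact lift (fun t => hE t _ ((hq.nat_mod h2.fst).nat_div h1.fst))
      (fun t => hE t _ ((hq.nat_mod h2.fst).nat_mod h1.fst)) hy (snd.nat_mod (const 3)) t

end SamplePoint

end PolyTime

/-! ### Writing the output -/

/-- A function computed in polynomial time can be tabulated in the output array. -/
theorem PolyTime.exists_prog {f : Input → ℕ → ℕ} (hf : PolyTime fun a : Input × ℕ => f a.1 a.2) :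
    ∃ (c : Prog) (T : Input → ℕ), PolyBounded T ∧ ∀ (I : Input) (s : State),
      (∀ A < 6, s.arr A = I.arr A) → s.var 0 = I.n → s.var 1 = I.k →
      ∃ t s', Runs c s t s' ∧ t ≤ T I ∧ ∀ i < I.k, s'.arr 6 i = f I i := by
  obtain ⟨c, T, hT, hc⟩ := hf.2 id 3 fun v hv => hv
  obtain ⟨T', hT', hle⟩ := hT.exists_bound (PolyBounded.input_k (α := Input))
  obtain ⟨H, hH, hfH⟩ := hf.1.exists_bound (PolyBounded.input_k (α := Input))
  have hk := PolyBounded.input_k (α := Input)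
  refine ⟨.seq (.assign 2 (.const 0)) (.loop (.op .sub (.var 1) (.var 2))
    (.seq c (.seq (.store 6 (.var 2) (.var 3)) (.assign 2 (.op .add (.var 2) (.const 1)))))),
    fun I => 2 + (I.k + 1) * (2 * (T' I + 2 * H I + (I.k + I.k + 20) * (I.k + I.k + 20)) + 1),
    ?_, fun I s hs h0 h1 => ?_⟩
  · exact (PolyBounded.const 2).add ((hk.add (.const 1)).mul
      (((PolyBounded.const 2).mul ((hT'.add ((PolyBounded.const 2).mul hH)).add
        (((hk.add hk).add (.const 20)).mul ((hk.add hk).add (.const 20))))).add (.const 1)))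
  let Inv : ℕ → State → Prop := fun i u => (∀ A < 6, u.arr A = I.arr A) ∧ u.var 0 = I.n ∧
    u.var 1 = I.k ∧ u.var 2 = i ∧ ∀ j < i, u.arr 6 j = f I j
  have hinv : Inv 0 (s.setVar 2 0) := by
    refine ⟨hs, ?_, ?_, ?_, fun j hj => absurd hj (Nat.not_lt_zero j)⟩
    · rw [State.setVar_var_of_ne (by omega), h0]
    · rw [State.setVar_var_of_ne (by omega), h1]
    · simp [State.setVar]
  have hcost : ∀ i ≤ I.k, ∀ u, Inv i u → (Exp.op .sub (.var 1) (.var 2)).cost u ≤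
      (I.k + I.k + 20) * (I.k + I.k + 20) := by
    rintro i hi u ⟨-, -, hum, hui, -⟩
    have h1 := bits_natCast_le i
    have h2 := bits_natCast_le I.k
    simp only [Exp.cost, Exp.eval, hum, hui]
    nlinarith [Nat.mul_le_mul h2 (h1.trans hi)]
  obtain ⟨t, s', r, ht, hs'⟩ := runs_loop
    (T := T' I + 2 * H I + (I.k + I.k + 20) * (I.k + I.k + 20)) (m := I.k)
    (e := .op .sub (.var 1) (.var 2))
    (c := .seq c (.seq (.store 6 (.var 2) (.var 3))
      (.assign 2 (.op .add (.var 2) (.const 1))))) Inv (fun i hi u hu => by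
      refine ⟨?_, (hcost i hi.le u hu).trans (Nat.le_add_left _ _), ?_⟩
      · simp only [Exp.eval, Op.eval, hu.2.2.1, hu.2.2.2.1]
        omega
      obtain ⟨hua, hu0, hu1, hu2, hu6⟩ := hu
      have hi' : bits (code i) ≤ I.k := (bits_natCast_le i).trans hi.le
      have hTi := hle I i hi'
      have hfi := hfH I i hi'
      obtain ⟨t₁, s₁, r₁, ht₁, ha₁, hv₁, hr₁⟩ := hc (I, i) u ⟨hua, fun v hv => by
        change v < 3 at hv
        interval_cases v
        · exact hu0
        · exact hu1
        · exact hu2⟩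
      have e2 : s₁.var 2 = i := by rw [hv₁ _ (by omega), hu2]
      refine ⟨_, _, .seq _ _ _ _ _ _ _ r₁ (.seq _ _ _ _ _ _ _ (.store _ _ _ _) (.assign _ _ _)),
        ?_, ?_, ?_, ?_, ?_, ?_⟩
      · have h1 := bits_natCast_le i
        have h2 := bits_natCast_le (i + 1)
        push_cast at h2
        simp only [Exp.cost, Exp.eval, Op.eval, State.setArr, hr₁, bits_one, e2]
        dsimp only at hfi
        nlinarith
      · intro A hA
        change Function.update s₁.arr 6 _ A = _
        rw [Function.update_of_ne (by omega), ha₁, hua A hA]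
      · rw [State.setVar_var_of_ne (by omega)]
        exact (hv₁ 0 (by omega)).trans hu0
      · rw [State.setVar_var_of_ne (by omega)]
        exact (hv₁ 1 (by omega)).trans hu1
      · simp [State.setVar, State.setArr, Exp.eval, Op.eval, e2]
      · intro j hj
        by_cases hji : j = i
        · simp [State.setVar, State.setArr, Exp.eval, e2, hji, hr₁]
        · simp [State.setVar, State.setArr, Exp.eval, e2, hji, ha₁, hu6 j (by omega)])
    (fun u hu => by
      refine ⟨?_, (hcost _ le_rfl u hu).trans (Nat.le_add_left _ _)⟩
      simp only [Exp.eval, Op.eval, hu.2.2.1, hu.2.2.2.1]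
      omega) hinv
  refine ⟨_, s', .seq _ _ _ _ _ _ _ (.assign _ _ _) r, ?_, hs'.2.2.2.2⟩
  simp only [Exp.cost, Exp.eval, bits_zero]
  omega

/-! ### The oracle problem over the integers -/

/-- The integral objective of a tuple `l`, given a number `S` and vectors `w i j` with `d + 1`
coordinates: with `c` the last coordinates and `v` the first `d` ones, it is `S ∑ c - ‖∑ v‖²`, the
sums being over the chosen vectors. -/
def objective (d k : ℕ) (S : ℤ) (w : ℕ → ℕ → ℕ → ℤ) (l : ℕ → ℕ) : ℤ :=
  S * ∑ i ∈ Finset.range k, w i (l i) d -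
    ∑ t ∈ Finset.range d, (∑ i ∈ Finset.range k, w i (l i) t) ^ 2

theorem objective_congr {d k : ℕ} {S : ℤ} {w : ℕ → ℕ → ℕ → ℤ} {l l' : ℕ → ℕ}
    (h : ∀ i < k, ∀ t ≤ d, w i (l i) t = w i (l' i) t) :
    objective d k S w l = objective d k S w l' := by
  have key : ∀ t ≤ d, ∑ i ∈ Finset.range k, w i (l i) t = ∑ i ∈ Finset.range k, w i (l' i) t :=
    fun t ht => Finset.sum_congr rfl fun i hi => h i (Finset.mem_range.1 hi) t ht
  unfold objective
  rw [key d le_rfl]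
  congr 1
  exact Finset.sum_congr rfl fun t ht => by rw [key t (Finset.mem_range.1 ht).le]

/-- The point that belongs to a tuple: `S` times its barycenter, in homogeneous coordinates and
scaled such that the linear forms `w i j` are to be minimized there. -/
def dualPoint (d k : ℕ) (S : ℤ) (w : ℕ → ℕ → ℕ → ℤ) (l : ℕ → ℕ) (t : ℕ) : ℤ :=
  if t < d then -2 * ∑ i ∈ Finset.range k, w i (l i) t else S

theorem lin_sub_left (D : ℕ) (g h u : ℕ → ℤ) :
    lin D (fun t => g t - h t) u = lin D g u - lin D h u := by
  simp only [lin, sub_mul, Finset.sum_sub_distrib]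

/-- The change of the objective if one entry of the tuple is replaced. -/
theorem objective_update {d k : ℕ} {S : ℤ} {w : ℕ → ℕ → ℕ → ℤ} {l : ℕ → ℕ} {i : ℕ} (hi : i < k)
    (j : ℕ) : objective d k S w (Function.update l i j) = objective d k S w l +
      lin (d + 1) (fun t => w i j t - w i (l i) t) (dualPoint d k S w l) -
      ∑ t ∈ Finset.range d, (w i j t - w i (l i) t) ^ 2 := by
  have key : ∀ t, ∑ i' ∈ Finset.range k, w i' (Function.update l i j i') t =
      ∑ i' ∈ Finset.range k, w i' (l i') t + (w i j t - w i (l i) t) := by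
    intro t
    rw [← sub_eq_iff_eq_add', ← Finset.sum_sub_distrib,
      Finset.sum_eq_single_of_mem i (Finset.mem_range.2 hi), Function.update_self]
    intro i' _ hne
    rw [Function.update_of_ne hne, sub_self]
  have hlin : lin (d + 1) (fun t => w i j t - w i (l i) t) (dualPoint d k S w l) =
      ∑ t ∈ Finset.range d, (w i j t - w i (l i) t) *
        (-2 * ∑ i ∈ Finset.range k, w i (l i) t) + (w i j d - w i (l i) d) * S := by
    rw [lin_succ]
    congr 1
    · exact Finset.sum_congr rfl fun t ht => by rw [dualPoint, if_pos (Finset.mem_range.1 ht)]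
    · rw [dualPoint, if_neg (lt_irrefl d)]
  have hsq : ∑ t ∈ Finset.range d, (∑ i ∈ Finset.range k, w i (l i) t +
      (w i j t - w i (l i) t)) ^ 2 =
      ∑ t ∈ Finset.range d, (∑ i ∈ Finset.range k, w i (l i) t) ^ 2 -
      ∑ t ∈ Finset.range d, (w i j t - w i (l i) t) *
        (-2 * ∑ i ∈ Finset.range k, w i (l i) t) +
      ∑ t ∈ Finset.range d, (w i j t - w i (l i) t) ^ 2 := by
    rw [← Finset.sum_sub_distrib, ← Finset.sum_add_distrib]
    exact Finset.sum_congr rfl fun t _ => by ring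
  unfold objective
  simp only [key]
  rw [hlin, hsq]
  ring

/-- At the dual point of an optimal tuple `l`, the vector `w i (l i)` is the only minimizer among
the vectors `w i j`. -/
theorem lin_dualPoint_lt {d k n : ℕ} {S : ℤ} (hS : 0 < S) {w : ℕ → ℕ → ℕ → ℤ} {l : ℕ → ℕ}
    (hl : ∀ i < k, l i < n)
    (hopt : ∀ l' : ℕ → ℕ, (∀ i < k, l' i < n) → objective d k S w l ≤ objective d k S w l')
    {i j : ℕ} (hi : i < k) (hj : j < n) (hne : ∃ t ≤ d, w i j t ≠ w i (l i) t) :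
    0 < lin (d + 1) (fun t => w i j t - w i (l i) t) (dualPoint d k S w l) := by
  have h := hopt (Function.update l i j) fun i' hi' => by
    by_cases e : i' = i
    · rw [e, Function.update_self]
      exact hj
    · rw [Function.update_of_ne e]
      exact hl i' hi'
  rw [objective_update hi] at h
  have hnn : ∀ t ∈ Finset.range d, 0 ≤ (w i j t - w i (l i) t) ^ 2 := fun t _ => sq_nonneg _
  by_cases hz : ∑ t ∈ Finset.range d, (w i j t - w i (l i) t) ^ 2 = 0
  · -- the first `d` coordinates agree, so that only the last one contributes
    rw [hz] at h
    rw [Finset.sum_eq_zero_iff_of_nonneg hnn] at hz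
    have hz' : ∀ t ∈ Finset.range d, w i j t - w i (l i) t = 0 := fun t ht =>
      pow_eq_zero_iff two_ne_zero |>.1 (hz t ht)
    have e : lin (d + 1) (fun t => w i j t - w i (l i) t) (dualPoint d k S w l) =
        (w i j d - w i (l i) d) * S := by
      rw [lin_succ, dualPoint, if_neg (lt_irrefl d), lin, Finset.sum_eq_zero, zero_add]
      intro t ht
      rw [hz' t ht, zero_mul]
    obtain ⟨t, ht, hne⟩ := hne
    rw [e] at h ⊢
    have hd : w i j d - w i (l i) d ≠ 0 := by
      rcases ht.lt_or_eq with ht | rfl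
      · exact absurd (sub_eq_zero.1 (hz' t (Finset.mem_range.2 ht))) hne
      · exact sub_ne_zero.2 hne
    have : (w i j d - w i (l i) d) * S ≠ 0 := mul_ne_zero hd hS.ne'
    omega
  · have := lt_of_le_of_ne (Finset.sum_nonneg hnn) (Ne.symm hz)
    omega

/-- The differences `w i b - w i a`, as a family of linear forms; the triple `(i, a, b)` has the
number `(i * n + a) * n + b`, and the vectors are numbered by `i * n + j`. -/
def differences (n : ℕ) (vec : ℕ → ℕ → ℤ) (m t : ℕ) : ℤ :=
  vec (m / (n * n) * n + m % n) t - vec (m / n) t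

theorem differences_apply {n : ℕ} (vec : ℕ → ℕ → ℤ) (i : ℕ) {a b : ℕ} (ha : a < n) (hb : b < n) :
    differences n vec ((i * n + a) * n + b) =
      fun t => vec (i * n + b) t - vec (i * n + a) t := by
  have hn : 0 < n := by omega
  have h1 : ((i * n + a) * n + b) / n = i * n + a := by
    rw [mul_comm, Nat.mul_add_div hn, Nat.div_eq_of_lt hb, add_zero]
  have h2 : ((i * n + a) * n + b) % n = b := by rw [mul_comm, Nat.mul_add_mod, Nat.mod_eq_of_lt hb]
  have h3 : (i * n + a) / n = i := by
    rw [mul_comm, Nat.mul_add_div hn, Nat.div_eq_of_lt ha, add_zero]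
  funext t
  rw [differences, ← Nat.div_div_eq_div_mul, h1, h2, h3]

/-- The tuple that belongs to the sample point number `q`: for every `i` it selects a vector at
which this point, as a linear form, is minimal. -/
def candidate (d n k : ℕ) (vec : ℕ → ℕ → ℤ) (q i : ℕ) : ℕ :=
  argminBelow (fun j => lin (d + 1) (vec (i * n + j))
    (samplePoint (d + 1) (k * n * n) (differences n vec) q)) n

/-- The sample point whose tuple has the least objective. -/
def bestSample (d n k : ℕ) (S : ℤ) (vec : ℕ → ℕ → ℤ) : ℕ :=
  argminBelow (fun q => objective d k S (fun i j => vec (i * n + j)) (candidate d n k vec q))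
    (sampleCount (d + 1) (k * n * n))

theorem candidate_lt {d n k : ℕ} (hn : 0 < n) (vec : ℕ → ℕ → ℤ) (q i : ℕ) :
    candidate d n k vec q i < n := argminBelow_lt _ hn

/-- The best of the candidates is an optimal tuple. -/
theorem objective_bestSample_le {d n k : ℕ} {S : ℤ} (hS : 0 < S) (hn : 0 < n) (vec : ℕ → ℕ → ℤ)
    {l' : ℕ → ℕ} (hl' : ∀ i < k, l' i < n) :
    objective d k S (fun i j => vec (i * n + j))
        (candidate d n k vec (bestSample d n k S vec)) ≤
      objective d k S (fun i j => vec (i * n + j)) l' := by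
  set w : ℕ → ℕ → ℕ → ℤ := fun i j => vec (i * n + j) with hw
  let ext : (Fin k → Fin n) → ℕ → ℕ := fun j i => if h : i < k then j ⟨i, h⟩ else 0
  have hext : ∀ l : ℕ → ℕ, (∀ i < k, l i < n) →
      ∃ j, objective d k S w (ext j) = objective d k S w l := fun l hl =>
    ⟨fun i => ⟨l i, hl i i.2⟩, objective_congr fun i hi t _ => by simp [ext, hi]⟩
  have : Nonempty (Fin n) := ⟨⟨0, hn⟩⟩
  obtain ⟨j₀, hj₀⟩ := Finite.exists_min fun j => objective d k S w (ext j)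
  set l := ext j₀ with hl0
  have hl : ∀ i < k, l i < n := fun i hi => by simp [hl0, ext, hi]
  have hopt : ∀ l' : ℕ → ℕ, (∀ i < k, l' i < n) → objective d k S w l ≤ objective d k S w l' := by
    intro l' hl'
    obtain ⟨j, hj⟩ := hext l' hl'
    exact hj ▸ hj₀ j
  obtain ⟨q, hq, hsample⟩ := exists_samplePoint (d + 1) (k * n * n) (differences n vec)
    (dualPoint d k S w l)
  have hcand : objective d k S w (candidate d n k vec q) = objective d k S w l := by
    refine objective_congr fun i hi t ht => ?_
    by_contra hne
    set j := candidate d n k vec q i with hj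
    have hjn : j < n := candidate_lt hn vec q i
    have h1 := lin_dualPoint_lt hS hl hopt hi hjn ⟨t, ht, hne⟩
    have hidx : (i * n + l i) * n + j < k * n * n := by
      have h2 : (i + 1) * n ≤ k * n := Nat.mul_le_mul_right n hi
      have h3 : (i * n + l i + 1) * n ≤ k * n * n :=
        Nat.mul_le_mul_right n (by have := hl i hi; linarith)
      linarith
    have h4 := hsample _ hidx
    rw [differences_apply vec i (hl i hi) hjn] at h4
    have h5 := h4 h1
    rw [lin_sub_left] at h5
    have h6 := argminBelow_min (fun j => lin (d + 1) (vec (i * n + j))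
      (samplePoint (d + 1) (k * n * n) (differences n vec) q)) (hl i hi)
    change lin (d + 1) (vec (i * n + j)) _ ≤ _ at h6
    linarith
  calc _ ≤ objective d k S w (candidate d n k vec q) :=
        argminBelow_min (fun q => objective d k S w (candidate d n k vec q)) hq
    _ = objective d k S w l := hcand
    _ ≤ _ := hopt l' hl'

/-! ### Clearing denominators -/

/-- The product of all the denominators of the input. -/
def denom (d : ℕ) (I : Input) : ℤ :=
  (∏ i ∈ Finset.range I.k, I.arr 1 i) * (∏ a ∈ Finset.range (I.k * I.n), I.arr 3 a) *
    ∏ a ∈ Finset.range (I.k * I.n * d), I.arr 5 a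

/-- The rational number with numerator in the array `A` and denominator in the array `B`, times the
common denominator. -/
def scaled (d A B : ℕ) (I : Input) (a : ℕ) : ℤ := I.arr A a * (denom d I / I.arr B a)

/-- The vectors of the integral problem: with weights `Λ`, points `X` and potentials `p` scaled by
the common denominator `D`, the vector number `a = i * n + j` is `Λ X`, followed by the last
coordinate `Λ ‖X‖² - D² p`. -/
def vector (d : ℕ) (I : Input) (a t : ℕ) : ℤ :=
  if t < d then scaled d 0 1 I (a / I.n) * scaled d 4 5 I (a * d + t)
  else scaled d 0 1 I (a / I.n) * ∑ t ∈ Finset.range d, scaled d 4 5 I (a * d + t) ^ 2 -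
    denom d I ^ 2 * scaled d 2 3 I a

/-- The sum of the scaled weights. -/
def totalWeight (d : ℕ) (I : Input) : ℤ := ∑ i ∈ Finset.range I.k, scaled d 0 1 I i

/-- The tuple computed by the algorithm. -/
def answer (d : ℕ) (I : Input) (i : ℕ) : ℕ :=
  candidate d I.n I.k (vector d I) (bestSample d I.n I.k (totalWeight d I) (vector d I)) i

namespace PolyTime

theorem denom (d : ℕ) : PolyTime (denom d) := by
  have hn := input_n (α := Input)
  have hk := input_k (α := Input)
  have hnb := PolyBounded.input_n (α := Input)
  have hkb := PolyBounded.input_k (α := Input)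
  exact ((prod hk hkb (read (by omega) snd)).mul
    (prod (hk.nat_mul hn) (hkb.mul hnb) (read (by omega) snd))).mul
    (prod ((hk.nat_mul hn).nat_mul (const d)) ((hkb.mul hnb).mul (.const d)) (read (by omega) snd))

theorem scaled (d : ℕ) {A B : ℕ} (hA : A < 6) (hB : B < 6) :
    PolyTime fun a : Input × ℕ => scaled d A B a.1 a.2 :=
  (read hA snd).mul ((denom d).fst.div (read hB snd))

theorem vector (d t : ℕ) : PolyTime fun a : Input × ℕ => vector d a.1 a.2 t := by
  have h1 : PolyTime fun a : Input × ℕ => BarySep.scaled d 0 1 a.1 (a.2 / a.1.n) :=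
    comp (scaled d (by omega) (by omega)) (snd.nat_div input_n)
  have h2 : ∀ t, PolyTime fun a : Input × ℕ => BarySep.scaled d 4 5 a.1 (a.2 * d + t) := fun t =>
    comp (scaled d (by omega) (by omega)) ((snd.nat_mul (const d)).nat_add (const t))
  unfold BarySep.vector
  split
  · exact h1.mul (h2 t)
  · exact (h1.mul (finset_sum d fun t => (h2 t).pow 2)).sub
      (((denom d).fst.pow 2).mul (scaled d (by omega) (by omega)))

theorem totalWeight (d : ℕ) : PolyTime (totalWeight d) :=
  sum input_k .input_k (scaled d (by omega) (by omega))

theorem differences (d t : ℕ) :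
    PolyTime fun a : Input × ℕ => differences a.1.n (BarySep.vector d a.1) a.2 t := by
  have hn := input_n (α := Input × ℕ)
  exact (comp (f := fun I m => BarySep.vector d I m t) (vector d t)
    (((snd.nat_div (hn.nat_mul hn)).nat_mul hn).nat_add (snd.nat_mod hn))).sub
    (comp (f := fun I m => BarySep.vector d I m t) (vector d t) (snd.nat_div hn))

theorem argmin_lin (D : ℕ) {V U : Input → ℕ → ℕ → ℤ}
    (hV : ∀ t, PolyTime fun a : Input × ℕ => V a.1 a.2 t)
    (hU : ∀ t, PolyTime fun a : Input × ℕ => U a.1 a.2 t) :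
    PolyTime fun a : (Input × ℕ) × ℕ =>
      argminBelow (fun j => BarySep.lin D (V a.1.1 (a.2 * a.1.1.n + j)) (U a.1.1 a.1.2)) a.1.1.n :=
  argmin input_n .input_n (lin
    (fun t => comp (f := fun I m => V I m t) (hV t) ((snd.fst.nat_mul input_n).nat_add snd))
    fun t => comp (f := fun I q => U I q t) (hU t) snd.fst.fst)

theorem candidate (d : ℕ) : PolyTime fun a : (Input × ℕ) × ℕ =>
    candidate d a.1.1.n a.1.1.k (BarySep.vector d a.1.1) a.1.2 a.2 := by
  have hM : PolyTime fun I : Input => I.k * I.n * I.n :=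
    (input_k (α := Input)).nat_mul input_n |>.nat_mul input_n
  have hU : ∀ D t, PolyTime fun a : Input × ℕ => BarySep.samplePoint D
      (a.1.k * a.1.n * a.1.n) (BarySep.differences a.1.n (BarySep.vector d a.1)) a.2 t := fun D =>
    samplePoint (F := fun I => BarySep.differences I.n (BarySep.vector d I)) D hM (differences d)
  exact argmin_lin (d + 1) (V := BarySep.vector d) (U := fun I => BarySep.samplePoint (d + 1)
    (I.k * I.n * I.n) (BarySep.differences I.n (BarySep.vector d I))) (vector d) (hU (d + 1))

theorem bestSample (d : ℕ) : PolyTime fun I : Input =>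
    bestSample d I.n I.k (BarySep.totalWeight d I) (BarySep.vector d I) := by
  have hM : PolyTime fun I : Input => I.k * I.n * I.n :=
    (input_k (α := Input)).nat_mul input_n |>.nat_mul input_n
  have hMb : PolyBounded fun I : Input => I.k * I.n * I.n :=
    (PolyBounded.input_k (α := Input)).mul .input_n |>.mul .input_n
  obtain ⟨h1, h2⟩ := sampleCount (d + 1) hM hMb
  have hw : ∀ t, PolyTime fun a : Input × ℕ => ∑ i ∈ Finset.range a.1.k,
      BarySep.vector d a.1 (i * a.1.n +
        BarySep.candidate d a.1.n a.1.k (BarySep.vector d a.1) a.2 i) t := fun t =>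
    sum (f := fun a : Input × ℕ => fun i => BarySep.vector d a.1 (i * a.1.n +
        BarySep.candidate d a.1.n a.1.k (BarySep.vector d a.1) a.2 i) t) input_k .input_k
      (comp (f := fun I m => BarySep.vector d I m t) (vector d t)
        ((snd.nat_mul input_n).nat_add (candidate d)))
  exact argmin (f := fun I q => objective d I.k (BarySep.totalWeight d I)
      (fun i j => BarySep.vector d I (i * I.n + j))
      (BarySep.candidate d I.n I.k (BarySep.vector d I) q)) h1 h2
    (((totalWeight d).fst.mul (hw d)).sub (finset_sum d fun t => (hw t).pow 2))

theorem answer (d : ℕ) : PolyTime fun a : Input × ℕ => answer d a.1 a.2 :=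
  comp₂ (f := fun I q i => BarySep.candidate d I.n I.k (BarySep.vector d I) q i) (candidate d)
    (bestSample d).fst snd

end PolyTime

/-! ### The integral objective and the barycenter cost -/

section Real

variable {d n k : ℕ}

/-- The barycenter cost in closed form. -/
theorem sum_mul_barycenterCost (lam : Fin k → ℝ) (hlam : ∀ i, 0 < lam i) (hk : 0 < k)
    (x : Fin k → Fin n → EuclideanSpace ℝ (Fin d)) (j : Fin k → Fin n) :
    (∑ i, lam i) * barycenterCost lam x j =
      (∑ i, lam i) * ∑ i, lam i * ∑ t, x i (j i) t ^ 2 - ∑ t, (∑ i, lam i * x i (j i) t) ^ 2 := by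
  have : Nonempty (Fin k) := ⟨⟨0, hk⟩⟩
  have hL : 0 < ∑ i, lam i := Finset.sum_pos (fun i _ => hlam i) Finset.univ_nonempty
  obtain ⟨y, hy, hmin⟩ := exists_eq_barycenterCost lam hlam x j
  have key : ∀ z : EuclideanSpace ℝ (Fin d), (∑ i, lam i) * ∑ i, lam i * ‖x i (j i) - z‖ ^ 2 =
      (∑ i, lam i) * ∑ i, lam i * ∑ t, x i (j i) t ^ 2 - ∑ t, (∑ i, lam i * x i (j i) t) ^ 2 +
        ∑ t, ((∑ i, lam i) * z t - ∑ i, lam i * x i (j i) t) ^ 2 := by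
    intro z
    have h1 : ∑ i, lam i * ‖x i (j i) - z‖ ^ 2 = ∑ i, lam i * ∑ t, x i (j i) t ^ 2 +
        ∑ t, (-2 * z t * ∑ i, lam i * x i (j i) t + z t ^ 2 * ∑ i, lam i) := by
      simp only [EuclideanSpace.real_norm_sq_eq, Finset.mul_sum]
      rw [← Finset.sum_comm (s := Finset.univ (α := Fin d)),
        ← Finset.sum_comm (s := Finset.univ (α := Fin d)), ← Finset.sum_add_distrib]
      refine Finset.sum_congr rfl fun t _ => ?_
      rw [← Finset.sum_add_distrib, ← Finset.sum_add_distrib]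
      refine Finset.sum_congr rfl fun i _ => ?_
      rw [PiLp.sub_apply]
      ring
    rw [h1, mul_add, sub_add, ← Finset.sum_sub_distrib, sub_eq_add_neg, ← Finset.sum_neg_distrib,
      Finset.mul_sum (s := Finset.univ (α := Fin d))]
    congr 1
    exact Finset.sum_congr rfl fun t _ => by ring
  refine le_antisymm ?_ ?_
  · have h := mul_le_mul_of_nonneg_left
      (hmin (WithLp.toLp 2 fun t => (∑ i, lam i * x i (j i) t) / ∑ i, lam i)) hL.le
    rw [key] at h
    refine h.trans (le_of_eq ?_)
    rw [add_eq_left]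
    refine Finset.sum_eq_zero fun t _ => ?_
    simp only
    rw [mul_div_cancel₀ _ hL.ne', sub_self, sq, zero_mul]
  · rw [hy, key]
    exact le_add_of_nonneg_right (Finset.sum_nonneg fun t _ => sq_nonneg _)

end Real

/-! ### The input of the algorithm -/

section Glue

variable {d n k : ℕ}

theorem listArr_of_lt {m : ℕ} (v : Fin m → ℤ) {a : ℕ} (h : a < m) : listArr v a = v ⟨a, h⟩ :=
  dif_pos h

theorem bits_listArr_le {m : ℕ} {v : Fin m → ℤ} {L : ℕ} (h : ∀ a, bits (v a) ≤ L) (a : ℕ) :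
    bits (listArr v a) ≤ L := by
  unfold listArr
  split
  · exact h _
  · simp [bits_zero]

/-- The initial memory of the machine, with its size. -/
def oracleInput (L : ℕ) (lam : Fin k → ℚ) (x : Fin k → Fin n → Fin d → ℚ) (p : Fin k → Fin n → ℚ)
    (hlam : ∀ i, HasBits (lam i) L) (hx : ∀ i j t, HasBits (x i j t) L)
    (hp : ∀ i j, HasBits (p i j) L) : Input where
  n := n
  k := k
  arr := (inputState lam x p).arr
  size := n + k + L
  n_le := by omega
  k_le := by omega
  bits_arr_le a i := by
    refine le_trans (b := L) ?_ (by omega)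
    simp only [inputState]
    split
    · exact bits_listArr_le (fun b => (hlam b).1) i
    · exact bits_listArr_le (fun b => (hlam b).2) i
    · exact bits_listArr_le (fun b => (hp _ _).1) i
    · exact bits_listArr_le (fun b => (hp _ _).2) i
    · exact bits_listArr_le (fun b => (hx _ _ _).1) i
    · exact bits_listArr_le (fun b => (hx _ _ _).2) i
    · simp [bits_zero]

theorem mul_add_lt {m : ℕ} {i j : ℕ} (hi : i < m) (hj : j < n) : i * n + j < m * n := by
  have : (i + 1) * n ≤ m * n := Nat.mul_le_mul_right n hi
  rw [Nat.succ_mul] at this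
  omega

theorem mul_add_div_left {i j : ℕ} (hj : j < n) : (i * n + j) / n = i := by
  rw [mul_comm, Nat.mul_add_div (by omega), Nat.div_eq_of_lt hj, add_zero]

theorem mul_add_mod_left {i j : ℕ} (hj : j < n) : (i * n + j) % n = j := by
  rw [mul_comm, Nat.mul_add_mod, Nat.mod_eq_of_lt hj]

theorem flatPotentials_apply (p : Fin k → Fin n → ℚ) (i : Fin k) (j : Fin n)
    (h : (i : ℕ) * n + j < k * n) : flatPotentials p ⟨i * n + j, h⟩ = p i j := by
  have e₁ : (⟨i * n + j, h⟩ : Fin (k * n)).divNat = i := Fin.ext (mul_add_div_left j.2)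
  have e₂ : (⟨i * n + j, h⟩ : Fin (k * n)).modNat = j := Fin.ext (mul_add_mod_left j.2)
  rw [flatPotentials, e₁, e₂]

theorem flatPoints_apply (x : Fin k → Fin n → Fin d → ℚ) (i : Fin k) (j : Fin n) (t : Fin d)
    (h : ((i : ℕ) * n + j) * d + t < k * n * d) :
    flatPoints x ⟨(i * n + j) * d + t, h⟩ = x i j t := by
  have e₁ : (⟨(i * n + j) * d + t, h⟩ : Fin (k * n * d)).divNat =
      ⟨i * n + j, mul_add_lt i.2 j.2⟩ := Fin.ext (mul_add_div_left t.2)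
  have e₂ : (⟨(i * n + j) * d + t, h⟩ : Fin (k * n * d)).modNat = t :=
    Fin.ext (mul_add_mod_left t.2)
  have e₃ : (⟨i * n + j, mul_add_lt i.2 j.2⟩ : Fin (k * n)).divNat = i :=
    Fin.ext (mul_add_div_left j.2)
  have e₄ : (⟨i * n + j, mul_add_lt i.2 j.2⟩ : Fin (k * n)).modNat = j :=
    Fin.ext (mul_add_mod_left j.2)
  rw [flatPoints, e₁, e₂, e₃, e₄]

theorem scaled_eq {A B : ℕ} {I : Input} {a : ℕ} {q : ℚ} (hA : I.arr A a = q.num)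
    (hB : I.arr B a = q.den) (hdvd : I.arr B a ∣ denom d I) :
    (scaled d A B I a : ℝ) = denom d I * q := by
  obtain ⟨c, hc⟩ := hdvd
  have hq : (q.den : ℝ) ≠ 0 := by exact_mod_cast q.den_nz
  have hq' : (q.den : ℤ) ≠ 0 := by exact_mod_cast q.den_nz
  rw [scaled, hc, hA, hB, Int.mul_ediv_cancel_left _ hq', Rat.cast_def]
  push_cast
  field_simp

variable {L : ℕ} {lam : Fin k → ℚ} {x : Fin k → Fin n → Fin d → ℚ} {p : Fin k → Fin n → ℚ}
  (hlam : ∀ i, HasBits (lam i) L) (hx : ∀ i j t, HasBits (x i j t) L)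
  (hp : ∀ i j, HasBits (p i j) L)

theorem denom_pos : 0 < denom d (oracleInput L lam x p hlam hx hp) := by
  have key : ∀ (m : ℕ) (v : Fin m → ℚ),
      0 < ∏ a ∈ Finset.range m, listArr (fun b => ((v b).den : ℤ)) a := fun m v =>
    Finset.prod_pos fun a ha => by
      rw [listArr_of_lt _ (Finset.mem_range.1 ha)]
      exact_mod_cast (v _).den_pos
  exact mul_pos (mul_pos (key k lam) (key _ (flatPotentials p))) (key _ (flatPoints x))

theorem scaled_weight (i : Fin k) : (scaled d 0 1 (oracleInput L lam x p hlam hx hp) i : ℝ) =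
    denom d (oracleInput L lam x p hlam hx hp) * lam i :=
  scaled_eq (listArr_of_lt (fun b => (lam b).num) i.2)
    (listArr_of_lt (fun b => ((lam b).den : ℤ)) i.2)
    (Dvd.dvd.mul_right (Dvd.dvd.mul_right (Finset.dvd_prod_of_mem _ (Finset.mem_range.2 i.2)) _) _)

theorem scaled_potential (i : Fin k) (j : Fin n) :
    (scaled d 2 3 (oracleInput L lam x p hlam hx hp) (i * n + j) : ℝ) =
      denom d (oracleInput L lam x p hlam hx hp) * p i j := by
  have h := mul_add_lt i.2 j.2
  rw [← flatPotentials_apply p i j h]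
  exact scaled_eq (listArr_of_lt (fun b => (flatPotentials p b).num) h)
    (listArr_of_lt (fun b => ((flatPotentials p b).den : ℤ)) h)
    (Dvd.dvd.mul_right (Dvd.dvd.mul_left (Finset.dvd_prod_of_mem _ (Finset.mem_range.2 h)) _) _)

theorem scaled_coordinate (i : Fin k) (j : Fin n) (t : Fin d) :
    (scaled d 4 5 (oracleInput L lam x p hlam hx hp) ((i * n + j) * d + t) : ℝ) =
      denom d (oracleInput L lam x p hlam hx hp) * x i j t := by
  have h := mul_add_lt (mul_add_lt i.2 j.2) t.2
  rw [← flatPoints_apply x i j t h]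
  exact scaled_eq (listArr_of_lt (fun b => (flatPoints x b).num) h)
    (listArr_of_lt (fun b => ((flatPoints x b).den : ℤ)) h)
    (Dvd.dvd.mul_left (Finset.dvd_prod_of_mem _ (Finset.mem_range.2 h)) _)

theorem totalWeight_eq : (totalWeight d (oracleInput L lam x p hlam hx hp) : ℝ) =
    denom d (oracleInput L lam x p hlam hx hp) * ∑ i, (lam i : ℝ) := by
  rw [totalWeight, Finset.mul_sum, Finset.sum_range]
  push_cast
  exact Finset.sum_congr rfl fun i _ => scaled_weight hlam hx hp i

theorem vector_coordinate (i : Fin k) (j : Fin n) (t : Fin d) :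
    (vector d (oracleInput L lam x p hlam hx hp) (i * n + j) t : ℝ) =
      denom d (oracleInput L lam x p hlam hx hp) ^ 2 * (lam i * x i j t) := by
  rw [vector, if_pos t.2, show (i * n + j : ℕ) / (oracleInput L lam x p hlam hx hp).n = i from
    mul_add_div_left j.2]
  push_cast
  rw [scaled_weight, scaled_coordinate]
  ring

theorem vector_last (i : Fin k) (j : Fin n) :
    (vector d (oracleInput L lam x p hlam hx hp) (i * n + j) d : ℝ) =
      denom d (oracleInput L lam x p hlam hx hp) ^ 3 *
        (lam i * ∑ t, (x i j t : ℝ) ^ 2 - p i j) := by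
  rw [vector, if_neg (lt_irrefl d), show (i * n + j : ℕ) / (oracleInput L lam x p hlam hx hp).n = i
    from mul_add_div_left j.2, Finset.sum_range]
  push_cast
  simp only [scaled_weight, scaled_coordinate, scaled_potential, mul_pow, ← Finset.mul_sum]
  ring

/-- The integral objective is the objective of the oracle problem, scaled by a positive number. -/
theorem objective_eq (hk : 0 < k) (hpos : ∀ i, 0 < lam i) {l : ℕ → ℕ} {j : Fin k → Fin n}
    (hl : ∀ i : Fin k, l i = j i) :
    (objective d k (totalWeight d (oracleInput L lam x p hlam hx hp))
      (fun i j => vector d (oracleInput L lam x p hlam hx hp) (i * n + j)) l : ℝ) =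
    denom d (oracleInput L lam x p hlam hx hp) ^ 4 * (∑ i, (lam i : ℝ)) *
      (barycenterCost (fun i => (lam i : ℝ))
        (fun i l => WithLp.toLp 2 (fun t => (x i l t : ℝ))) j - ∑ i, (p i (j i) : ℝ)) := by
  have h := sum_mul_barycenterCost (fun i => (lam i : ℝ)) (fun i => by exact_mod_cast hpos i) hk
    (fun i l => WithLp.toLp 2 (fun t => (x i l t : ℝ))) j
  rw [mul_sub, mul_assoc _ _ (barycenterCost _ _ _), h]
  unfold objective
  simp only [Finset.sum_range, hl]
  push_cast
  simp only [totalWeight_eq, vector_coordinate, vector_last, ← Finset.mul_sum, mul_pow,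
    Finset.sum_sub_distrib]
  ring

end Glue

end BarySep

theorem proposition3p2 (d : ℕ) :
    ∃ (prog : BarySep.Prog) (P : MvPolynomial (Fin 3) ℕ),
      ∀ (n k L : ℕ), 0 < n → 0 < k →
      ∀ (lam : Fin k → ℚ) (x : Fin k → Fin n → Fin d → ℚ) (p : Fin k → Fin n → ℚ),
        (∀ i, 0 < lam i) →
        (∀ i, BarySep.HasBits (lam i) L) →
        (∀ i j t, BarySep.HasBits (x i j t) L) →
        (∀ i j, BarySep.HasBits (p i j) L) →
        ∃ (T : ℕ) (s : BarySep.State) (j : Fin k → Fin n),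
          BarySep.Runs prog (BarySep.inputState lam x p) T s ∧
          T ≤ MvPolynomial.eval ![n, k, L] P ∧
          BarySep.Outputs s j ∧
          BarySep.IsSepAnswer
            (BarySep.barycenterCost (fun i => (lam i : ℝ))
              (fun i l => WithLp.toLp 2 (fun t => (x i l t : ℝ))))
            (fun i l => (p i l : ℝ)) j := by
  obtain ⟨prog, T, ⟨e, hT⟩, hprog⟩ := (BarySep.PolyTime.answer d).exists_prog
  refine ⟨prog, (3 * (MvPolynomial.X 0 + MvPolynomial.X 1 + MvPolynomial.X 2) + 2) ^ e,
    fun n k L hn hk lam x p hpos hlam hx hp => ?_⟩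
  set I := BarySep.oracleInput L lam x p hlam hx hp with hI
  obtain ⟨t, s, hr, ht, hout⟩ := hprog I (BarySep.inputState lam x p) (fun _ _ => rfl) rfl rfl
  have hlt : ∀ i, BarySep.answer d I i < n := fun i => BarySep.candidate_lt hn _ _ i
  refine ⟨t, s, fun i => ⟨BarySep.answer d I i, hlt i⟩, hr, ?_, fun i => hout i i.2, ?_⟩
  · refine ht.trans ((hT I).trans ?_)
    rw [BarySep.sz_input]
    have h1 := (BarySep.bits_natCast_le I.n).trans I.n_le
    have h2 := (BarySep.bits_natCast_le I.k).trans I.k_le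
    have h3 : I.size = n + k + L := rfl
    simp only [map_pow, map_add, map_mul, MvPolynomial.eval_X, map_ofNat]
    refine Nat.pow_le_pow_left ?_ e
    simp only [Matrix.cons_val_zero, Matrix.cons_val_one, Matrix.cons_val]
    omega
  · rw [BarySep.IsSepAnswer, isMinOn_iff]
    intro l _
    have hD : (0 : ℝ) < BarySep.denom d I := by exact_mod_cast BarySep.denom_pos hlam hx hp
    have hsum : (0 : ℝ) < ∑ i, (lam i : ℝ) :=
      Finset.sum_pos (fun i _ => by exact_mod_cast hpos i) ⟨⟨0, hk⟩, Finset.mem_univ _⟩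
    have hS : 0 < BarySep.totalWeight d I := by
      have : (0 : ℝ) < BarySep.totalWeight d I := by
        rw [BarySep.totalWeight_eq]
        exact mul_pos hD hsum
      exact_mod_cast this
    have h := BarySep.objective_bestSample_le (d := d) (k := k) hS hn (BarySep.vector d I)
      (l' := fun i => if h : i < k then l ⟨i, h⟩ else 0) fun i hi => by simp [hi]
    have h1 := BarySep.objective_eq hlam hx hp hk hpos
      (l := fun i => if h : i < k then l ⟨i, h⟩ else 0) (j := l) fun i => by simp
    have h2 := BarySep.objective_eq hlam hx hp hk hpos (l := BarySep.answer d I)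
      (j := fun i => ⟨BarySep.answer d I i, hlt i⟩) fun i => rfl
    rw [← Int.cast_le (R := ℝ)] at h
    exact le_of_mul_le_mul_left ((h2.symm.trans_le h).trans_eq h1) (by positivity)
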